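/- Let $t>0$ be fixed. For a prime $q\ge 3$, say that GRH holds modulo $q$ if, for every non-principal Dirichlet character $\chi$ (mod $q$), every zero of $L(s,\chi)$ with $0<\operatorname{Re} s<1$ satisfies $\operatorname{Re} s=\tfrac12$. Then there is a constant $C=C(t)$, depending only on $t$, such that for every prime $q\ge 3$ for which GRH holds modulo $q$, \[ \frac{1}{q-2}\sum_{\substack{\chi\,(\mathrm{mod}\ q)\\ \chi\ne\chi_0}} \operatorname*{ord}_{s=\frac12} L\!\left(s+\frac{2\pi i t}{\log q},\chi\right)\ \le\ \frac12\left(1+\left|\frac{\sin 4\pi t}{4\pi t}\right|\right)^{-1}+\frac{C}{\log q}, \] where $\chi_0$ is the principal character (mod $q$) and $\operatorname{ord}_{s=1/2}$ denotes the order of vanishing at $s=\tfrac12$. Moreover, for every $\varepsilon>0$ there is a $Q=Q(t,\varepsilon)$ such that for every prime $q\ge \max(Q,3)$ for which GRH holds modulo $q$, the proportion of primitive Dirichlet characters $\chi$ (mod $q$) for which $L\!\left(\tfrac12+\frac{2\pi i t}{\log q},\chi\right)\ne 0$ is at least \[ 1-\frac12\left(1+\left|\frac{\sin 4\pi t}{4\pi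 t}\right|\right)^{-1}-\varepsilon . \] -/

import Mathlib

/-- The generalized Riemann hypothesis for the Dirichlet `L`-functions of the non-principal
characters modulo `q`: every zero in the open critical strip lies on the critical line. -/
def GRHModulus (q : ℕ) [NeZero q] : Prop :=
  ∀ χ : DirichletCharacter ℂ q, χ ≠ 1 →
    ∀ s : ℂ, DirichletCharacter.LFunction χ s = 0 → 0 < s.re → s.re < 1 → s.re = 1 / 2

/-- The function `s ↦ L(s + 2πit / log q, χ)`. -/
noncomputable def shiftedL {q : ℕ} [NeZero q] (χ : DirichletCharacter ℂ q) (t : ℝ) (s : ℂ) : ℂ :=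
  DirichletCharacter.LFunction χ (s + 2 * (Real.pi : ℂ) * Complex.I * (t : ℂ) / (Real.log q : ℂ))

/-- The order of vanishing at `s = 1/2` of `s ↦ L(s + 2πit / log q, χ)`. -/
noncomputable def centralOrder {q : ℕ} [NeZero q] (χ : DirichletCharacter ℂ q) (t : ℝ) : ℕ :=
  analyticOrderNatAt (shiftedL χ t) (1 / 2)

/-- For non-principal `χ` the shifted `L`-function is entire. -/
theorem differentiable_shiftedL {q : ℕ} [NeZero q] (χ : DirichletCharacter ℂ q) (hχ : χ ≠ 1)
    (t : ℝ) : Differentiable ℂ (shiftedL χ t) :=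
  (DirichletCharacter.differentiable_LFunction hχ).comp (differentiable_id.add_const _)

/-- For non-principal `χ` the order of vanishing is finite, so `centralOrder` is the true one. -/
theorem coe_centralOrder {q : ℕ} [NeZero q] (χ : DirichletCharacter ℂ q) (hχ : χ ≠ 1) (t : ℝ) :
    (centralOrder χ t : ℕ∞) = analyticOrderAt (shiftedL χ t) (1 / 2) := by
  refine Nat.cast_analyticOrderNatAt fun h => ?_
  have hz := ((differentiable_shiftedL χ hχ t).differentiableOn.analyticOnNhd
    isOpen_univ).eqOn_zero_of_preconnected_of_eventuallyEq_zero isPreconnected_univ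
    (Set.mem_univ _) (analyticOrderAt_eq_top.1 h)
  have h2 := hz (Set.mem_univ
    (2 - 2 * (Real.pi : ℂ) * Complex.I * (t : ℂ) / (Real.log q : ℂ)))
  rw [shiftedL, sub_add_cancel] at h2
  exact DirichletCharacter.LFunction_ne_zero_of_one_le_re χ (Or.inl hχ) (by norm_num) h2

open Classical in
/-- `1/(q-2) * ∑_{χ ≠ χ₀} ord_{s=1/2} L(s + 2πit / log q, χ)`. -/
noncomputable def averageOrder (q : ℕ) [NeZero q] (t : ℝ) : ℝ :=
  1 / ((q : ℝ) - 2) *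
    ∑ χ ∈ (Finset.univ : Finset (DirichletCharacter ℂ q)) with χ ≠ 1, (centralOrder χ t : ℝ)

/-- The proportion of primitive characters `χ` modulo `q` with `L(1/2 + 2πit / log q, χ) ≠ 0`. -/
noncomputable def nonvanishingProportion (q : ℕ) [NeZero q] (t : ℝ) : ℝ :=
  ({χ : DirichletCharacter ℂ q | χ.IsPrimitive ∧ shiftedL χ t (1 / 2) ≠ 0}.ncard : ℝ) /
    ({χ : DirichletCharacter ℂ q | χ.IsPrimitive}.ncard : ℝ)

/-! Fix a non-principal `χ` modulo `q`; as `q` is prime, `χ` is primitive. Put `γ = 2πt / log q`,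
let `m` be the order of `L(s, χ)` at `1/2 + iγ` and `n` that of `L(s, χ⁻¹)` there. By complex
conjugation `L(s, χ)` vanishes to order at least `n` at `1/2 - iγ`. The plan is to bound `m + n` by
an explicit-formula inequality with a nonnegative test function, and to average over `χ`.

The inequality comes without a product over zeros. Divide out the two known zeros, `L = (s - a)^m (s
- b)^n k`, and set `ξ(s) = q^(s/2) γ(s) k(s)`, where this `γ(s)` is the gamma factor. The functional
equation gives `|ξ(s - h)| = |ξ(s + h)|` on the critical line. Under GRH the quotient `ξ(s - h) /
ξ(s + h)` is holomorphic to the right of that line, so Phragmén–Lindelöf bounds it by `1` there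
(`norm_xiFactor_div_le_one`). Letting `h → 0` yields `Re ξ'/ξ ≥ 0`, that is, the two zeros
contribute at most `(log q)/2` plus the real parts of the logarithmic derivatives of the gamma
factor and of `L` (`zeros_le_re_logDeriv`).

Integrate this along `Re s = 1/2 + δ` against a nonnegative `F` and let `δ → 0`
(`zeros_le_explicit`). The poles become Poisson kernels and give `π F(±γ)`; the integral of `L'/L`
is a sum over prime powers, found for large real part and continued analytically.

Take `F(y) = ĝ(y log q / 2π)²` with `g(v) = e(tv) + ε e(-tv)` on `[-1, 1]` and `ε` the sign of
`sin(4πt) / (4πt)`. With `A = 1 + |sin(4πt) / (4πt)|` one has `ĝ(±t)² = 4A²`, while the `(log q)/2`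
term contributes `4πA`. Hence `4πA² (m + n) ≤ 4πA` up to errors. Inversion permutes the characters,
so the mean of `m + n` is twice the mean order, which is therefore at most `1/(2A)` up to errors.

The gamma term is `O(1 / log q)` for each `χ`. The prime sum stops at `n < q²`, and orthogonality
leaves essentially `n ≡ 1 (mod q)`; since `g * g` vanishes linearly at the ends of its support, the
trivial bound for `Λ` makes the average `O(1 / log q)` (`norm_sum_primeSum_le`). The nonvanishing
statement follows because a vanishing `L`-value contributes at least `1` to the sum of orders. -/

open Filter Topology MeasureTheory ComplexConjugate

set_option linter.unusedSectionVars false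

/-! ### Conjugation symmetry and the functional equation in absolute value. -/

section
open DirichletCharacter

theorem gammaFactor_ne_zero {q : ℕ} (χ : DirichletCharacter ℂ q) {s : ℂ} (hs : 0 < s.re) :
    gammaFactor χ s ≠ 0 := by
  rw [gammaFactor]
  split_ifs
  · exact Complex.Gammaℝ_ne_zero_of_re_pos hs
  · exact Complex.Gammaℝ_ne_zero_of_re_pos (by simp; linarith)

theorem Gammaℝ_conj (s : ℂ) : Complex.Gammaℝ (conj s) = conj (Complex.Gammaℝ s) := by
  rw [Complex.Gammaℝ_def, Complex.Gammaℝ_def, map_mul, ← Complex.Gamma_conj]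
  have h2 : conj (2 : ℂ) = 2 := Complex.conj_ofNat 2
  have : -(conj s) / 2 = conj (-s / 2) := by simp [h2]
  rw [this, Complex.cpow_conj _ _ (by
    rw [Complex.arg_ofReal_of_nonneg Real.pi_pos.le]; exact Real.pi_ne_zero.symm), Complex.conj_ofReal]
  simp [h2]

theorem gammaFactor_inv_conj {q : ℕ} (χ : DirichletCharacter ℂ q) (s : ℂ) :
    gammaFactor χ⁻¹ (conj s) = conj (gammaFactor χ s) := by
  have h : (χ⁻¹).Even ↔ χ.Even := by
    have h (χ : DirichletCharacter ℂ q) (h : χ.Even) : (χ⁻¹).Even := by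
      rw [DirichletCharacter.Even] at *
      rw [MulChar.inv_apply_eq_inv', h, inv_one]
    exact ⟨fun h' => by simpa using h _ h', h χ⟩
  rcases χ.even_or_odd with he | ho
  · rw [he.gammaFactor_def, (h.2 he).gammaFactor_def, Gammaℝ_conj]
  · have ho' : (χ⁻¹).Odd := (χ⁻¹).even_or_odd.resolve_left fun h' => absurd (h.1 h') ho.not_even
    rw [ho.gammaFactor_def, ho'.gammaFactor_def, ← Gammaℝ_conj]; simp

variable {q : ℕ} [NeZero q]

/-- The values of `χ⁻¹` are the conjugates of those of `χ`, so the Dirichlet series agree for `Re s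
> 1`; the identity theorem does the rest. -/
theorem LFunction_inv_conj (χ : DirichletCharacter ℂ q) (hχ : χ ≠ 1) (s : ℂ) :
    LFunction χ⁻¹ (conj s) = conj (LFunction χ s) := by
  have h1 : Differentiable ℂ (fun s => conj (LFunction χ (conj s))) := fun s =>
    differentiableAt_conj_conj_iff.2 (differentiable_LFunction hχ _)
  have h2 : Differentiable ℂ (LFunction χ⁻¹) := differentiable_LFunction (inv_ne_one.2 hχ)
  have h3 : (fun s => conj (LFunction χ (conj s))) = LFunction χ⁻¹ := by
    refine AnalyticOnNhd.eq_of_eventuallyEq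
      (h1.differentiableOn.analyticOnNhd isOpen_univ) (h2.differentiableOn.analyticOnNhd isOpen_univ)
      (z₀ := 2) ?_
    filter_upwards [(isOpen_lt continuous_const Complex.continuous_re).mem_nhds
      (show (1 : ℝ) < (2 : ℂ).re by norm_num)] with z hz
    have hz' : 1 < z.re := hz
    rw [LFunction_eq_LSeries χ (by simpa using hz'), LFunction_eq_LSeries χ⁻¹ hz', LSeries, LSeries,
      Complex.conj_tsum]
    refine tsum_congr fun n => ?_
    rcases eq_or_ne n 0 with rfl | hn
    · simp
    · rw [LSeries.term_of_ne_zero hn, LSeries.term_of_ne_zero hn, map_div₀, ← MulChar.star_apply',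
        Complex.cpow_conj (n : ℂ) z (by simp [Complex.natCast_arg, Real.pi_ne_zero.symm]),
        Complex.conj_conj, Complex.conj_natCast]
      rfl
  rw [← h3]; simp

theorem completedLFunction_eq (χ : DirichletCharacter ℂ q) {s : ℂ} (hs : 0 < s.re) :
    completedLFunction χ s = gammaFactor χ s * LFunction χ s := by
  rw [LFunction_eq_completed_div_gammaFactor χ s (Or.inl (by rintro rfl; simp at hs)),
    mul_div_cancel₀ _ (gammaFactor_ne_zero χ hs)]

/-- The functional equation on absolute values, for a primitive character without zeros to the
right of the critical line. -/
theorem norm_functional_equation (χ : DirichletCharacter ℂ q) (hχ : χ ≠ 1) (hp : χ.IsPrimitive)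
    (hz : ∀ s : ℂ, 1 / 2 < s.re → LFunction χ s ≠ 0) {s : ℂ} (h0 : 0 < s.re) (h1 : s.re < 1) :
    ‖gammaFactor χ (1 - conj s) * LFunction χ (1 - conj s)‖ =
      (q : ℝ) ^ (s.re - 1 / 2) * ‖gammaFactor χ s * LFunction χ s‖ := by
  have hq : (0 : ℝ) < q := by exact_mod_cast NeZero.pos q
  have key : ∀ s : ℂ, 0 < s.re → s.re < 1 → ‖gammaFactor χ (1 - conj s) * LFunction χ (1 - conj s)‖ =
      (q : ℝ) ^ (s.re - 1 / 2) * ‖rootNumber χ‖ * ‖gammaFactor χ s * LFunction χ s‖ := by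
    intro s h0 h1
    rw [← completedLFunction_eq χ (by simpa using h1), hp.completedLFunction_one_sub,
      completedLFunction_eq _ (by simpa using h0), gammaFactor_inv_conj,
      LFunction_inv_conj _ hχ, ← map_mul, norm_mul, norm_mul, RCLike.norm_conj]
    congr 2
    rw [Complex.norm_natCast_cpow_of_pos (NeZero.pos q)]
    simp
  -- No Gauss sum is evaluated: applying `key` at `3/4` and at its reflection `1/4` multiplies a
  -- nonzero number by `‖rootNumber χ‖ ^ 2` and returns it unchanged.
  have hr : ‖rootNumber χ‖ = 1 := by
    have e1 := key (3 / 4) (by norm_num) (by norm_num)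
    have e2 := key (1 / 4) (by norm_num) (by norm_num)
    have c1 : (1 : ℂ) - conj (3 / 4 : ℂ) = 1 / 4 := by
      rw [map_div₀, map_ofNat, map_ofNat]; norm_num
    have c2 : (1 : ℂ) - conj (1 / 4 : ℂ) = 3 / 4 := by
      rw [map_div₀, map_ofNat, map_one]; norm_num
    rw [c1] at e1
    rw [c2, e1] at e2
    have hne : ‖gammaFactor χ (3 / 4) * LFunction χ (3 / 4)‖ ≠ 0 :=
      norm_ne_zero_iff.2 (mul_ne_zero (gammaFactor_ne_zero χ (by norm_num)) (hz _ (by norm_num)))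
    have e3 : (q : ℝ) ^ ((1 / 4 : ℂ).re - 1 / 2) * (q : ℝ) ^ ((3 / 4 : ℂ).re - 1 / 2) = 1 := by
      rw [← Real.rpow_add hq]; norm_num
    have e4 : ‖rootNumber χ‖ * ‖rootNumber χ‖ = 1 := by
      apply mul_right_cancel₀ hne
      linear_combination (-(1 : ℝ)) * e2 + -‖rootNumber χ‖ * ‖rootNumber χ‖ * ‖gammaFactor χ (3 / 4) * LFunction χ (3 / 4)‖ * e3
    nlinarith [norm_nonneg (rootNumber χ)]
  rw [key s h0 h1, hr, mul_one]

end

/-! ### Elementary bounds for `L(s, χ)` from partial summation. -/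

section
open DirichletCharacter

variable {q : ℕ} [NeZero q]

theorem sum_range_period_eq_zero (χ : DirichletCharacter ℂ q) (hχ : χ ≠ 1) :
    ∑ k ∈ Finset.range q, χ (k : ZMod q) = 0 := by
  rw [← χ.sum_eq_zero_of_ne_one hχ]
  symm
  refine Finset.sum_bij' (fun a _ => a.val) (fun k _ => (k : ZMod q)) ?_ ?_ ?_ ?_ ?_
  · intro a _; exact Finset.mem_range.2 a.val_lt
  · simp
  · simp
  · intro k hk; exact ZMod.val_cast_of_lt (Finset.mem_range.1 hk)
  · simp

theorem norm_sum_range_le (χ : DirichletCharacter ℂ q) (hχ : χ ≠ 1) (n : ℕ) :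
    ‖∑ k ∈ Finset.range n, χ (k : ZMod q)‖ ≤ q := by
  induction n using Nat.strong_induction_on with
  | _ n ih =>
    rcases lt_or_ge n q with h | h
    · calc _ ≤ ∑ k ∈ Finset.range n, ‖χ (k : ZMod q)‖ := norm_sum_le _ _
        _ ≤ ∑ k ∈ Finset.range n, 1 := Finset.sum_le_sum fun _ _ => χ.norm_le_one _
        _ = n := by simp
        _ ≤ q := by exact_mod_cast h.le
    · obtain ⟨m, rfl⟩ := Nat.exists_eq_add_of_le h
      rw [Finset.sum_range_add, sum_range_period_eq_zero χ hχ, zero_add]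
      simpa using ih m (by have := NeZero.pos q; omega)

theorem norm_sum_Icc_le (χ : DirichletCharacter ℂ q) (hχ : χ ≠ 1) (n : ℕ) :
    ‖∑ k ∈ Finset.Icc 1 n, χ (k : ZMod q)‖ ≤ q + 1 := by
  have h : ∑ k ∈ Finset.Icc 1 n, χ (k : ZMod q) = ∑ k ∈ Finset.range (n + 1), χ (k : ZMod q) - χ 0 := by
    rw [Finset.range_eq_Ico, Finset.sum_eq_sum_Ico_succ_bot (by omega)]
    simp only [Nat.cast_zero, add_sub_cancel_left]
    rfl
  rw [h]
  exact (norm_sub_le _ _).trans (add_le_add (norm_sum_range_le χ hχ _) (χ.norm_le_one _))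

/-- The partial sums of a character as a function on the real line, cut off below `1`. -/
noncomputable def charPartialSum (χ : DirichletCharacter ℂ q) : ℝ → ℂ :=
  (Set.Ioi (1 : ℝ)).indicator fun x => ∑ k ∈ Finset.Icc 1 ⌊x⌋₊, χ (k : ZMod q)

theorem norm_charPartialSum_le (χ : DirichletCharacter ℂ q) (hχ : χ ≠ 1) (x : ℝ) :
    ‖charPartialSum χ x‖ ≤ q + 1 :=
  (norm_indicator_le_norm_self _ _).trans (norm_sum_Icc_le χ hχ _)

theorem measurable_charPartialSum (χ : DirichletCharacter ℂ q) : Measurable (charPartialSum χ) := by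
  refine Measurable.indicator ?_ measurableSet_Ioi
  exact (measurable_from_nat (f := fun n : ℕ => ∑ k ∈ Finset.Icc 1 n, χ (k : ZMod q))).comp
    Nat.measurable_floor

theorem mellin_charPartialSum (χ : DirichletCharacter ℂ q) (s : ℂ) :
    mellin (charPartialSum χ) (-s) = ∫ t in Set.Ioi (1 : ℝ),
      (∑ k ∈ Finset.Icc 1 ⌊t⌋₊, χ (k : ZMod q)) * (t : ℂ) ^ (-(s + 1)) := by
  have h : ∀ t : ℝ, (t : ℂ) ^ (-s - 1) • charPartialSum χ t = (Set.Ioi (1 : ℝ)).indicator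
      (fun t : ℝ => (∑ k ∈ Finset.Icc 1 ⌊t⌋₊, χ (k : ZMod q)) * (t : ℂ) ^ (-(s + 1))) t := by
    intro t
    rw [charPartialSum, Set.indicator_apply, Set.indicator_apply]
    split_ifs
    · rw [smul_eq_mul, mul_comm, neg_add']
    · simp
  rw [mellin]
  simp_rw [h]
  rw [setIntegral_indicator measurableSet_Ioi, Set.inter_eq_right.2 (Set.Ioi_subset_Ioi zero_le_one)]

theorem differentiableAt_mellin_charPartialSum (χ : DirichletCharacter ℂ q) (hχ : χ ≠ 1) {s : ℂ}
    (hs : 0 < s.re) : DifferentiableAt ℂ (mellin (charPartialSum χ)) (-s) := by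
  -- Boundedness at infinity gives `a = 0`; as the function vanishes near `0`, any `b` below `-s.re`
  -- would serve.
  refine mellin_differentiableAt_of_isBigO_rpow (a := 0) (b := -s.re - 1) ?_ ?_ (by simpa using hs)
    ?_ (by simp)
  · refine LocallyIntegrable.locallyIntegrableOn ?_ _
    exact (locallyIntegrable_const ((q : ℝ) + 1)).mono
      (measurable_charPartialSum χ).aestronglyMeasurable
      (.of_forall fun x => (norm_charPartialSum_le χ hχ x).trans (le_abs_self _))
  · refine Asymptotics.IsBigO.of_bound (q + 1) (.of_forall fun x => ?_)
    simpa using norm_charPartialSum_le χ hχ x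
  · refine Asymptotics.IsBigO.of_bound 1 ?_
    filter_upwards [Ioo_mem_nhdsGT (show (0 : ℝ) < 1 by norm_num)] with x hx
    rw [charPartialSum, Set.indicator_of_notMem (by simpa using hx.2.le)]
    simp

/-- Abel summation for `Re s > 1`. The partial sums are bounded, so the Mellin transform is
holomorphic for `Re s > 0` and the identity extends there. -/
theorem LFunction_eq_mellin (χ : DirichletCharacter ℂ q) (hχ : χ ≠ 1) {s : ℂ} (hs : 0 < s.re) :
    LFunction χ s = s * mellin (charPartialSum χ) (-s) := by
  have ho : IsOpen {s : ℂ | 0 < s.re} := isOpen_lt continuous_const Complex.continuous_re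
  have h1 : AnalyticOnNhd ℂ (LFunction χ) {s : ℂ | 0 < s.re} :=
    (differentiable_LFunction hχ).differentiableOn.analyticOnNhd ho
  have h2 : AnalyticOnNhd ℂ (fun s => s * mellin (charPartialSum χ) (-s)) {s : ℂ | 0 < s.re} := by
    refine DifferentiableOn.analyticOnNhd (fun s hs => ?_) ho
    exact (differentiableAt_id.mul ((differentiableAt_mellin_charPartialSum χ hχ hs).comp s
      differentiableAt_id.neg)).differentiableWithinAt
  refine h1.eqOn_of_preconnected_of_eventuallyEq h2
    (convex_halfSpace_re_gt 0).isPreconnected (z₀ := 2) (by simp) ?_ hs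
  filter_upwards [(isOpen_lt continuous_const Complex.continuous_re).mem_nhds
      (show (1 : ℝ) < (2 : ℂ).re by norm_num)] with z hz
  have hz' : 1 < z.re := hz
  rw [LFunction_eq_LSeries χ hz', mellin_charPartialSum]
  refine LSeries_eq_mul_integral _ le_rfl (by linarith) ?_ ?_
  · exact (LSeriesSummable_iff (NeZero.ne q) χ).2 hz'
  · refine Asymptotics.IsBigO.of_bound (q + 1) (.of_forall fun n => ?_)
    simpa using norm_sum_Icc_le χ hχ n

theorem norm_LFunction_le (χ : DirichletCharacter ℂ q) (hχ : χ ≠ 1) {s : ℂ} (hs : 1 / 4 ≤ s.re) :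
    ‖LFunction χ s‖ ≤ 4 * (q + 1) * (1 + ‖s‖) := by
  have h0 : 0 < s.re := by linarith
  rw [LFunction_eq_mellin χ hχ h0, norm_mul, mellin_charPartialSum]
  have hb : ‖∫ t in Set.Ioi (1 : ℝ), (∑ k ∈ Finset.Icc 1 ⌊t⌋₊, χ (k : ZMod q)) *
      (t : ℂ) ^ (-(s + 1))‖ ≤ ∫ t in Set.Ioi (1 : ℝ), (q + 1) * t ^ (-(s.re + 1)) := by
    refine norm_integral_le_of_norm_le
      ((integrableOn_Ioi_rpow_of_lt (by linarith) one_pos).const_mul _) ?_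
    refine (ae_restrict_iff' measurableSet_Ioi).2 (.of_forall fun t ht => ?_)
    rw [norm_mul, Complex.norm_cpow_eq_rpow_re_of_pos (one_pos.trans ht)]
    have : (-(s + 1)).re = -(s.re + 1) := by simp
    rw [this]
    exact mul_le_mul_of_nonneg_right (norm_sum_Icc_le χ hχ _) (Real.rpow_nonneg (one_pos.trans ht).le _)
  rw [integral_const_mul, integral_Ioi_rpow_of_lt (by linarith) one_pos] at hb
  have e : (q + 1 : ℝ) * (-1 ^ (-(s.re + 1) + 1) / (-(s.re + 1) + 1)) = (q + 1) / s.re := by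
    rw [Real.one_rpow]
    have : -(s.re + 1) + 1 = - s.re := by ring
    rw [this, neg_div_neg_eq]; ring
  rw [e] at hb
  have : (q + 1 : ℝ) / s.re ≤ 4 * (q + 1) := by
    rw [div_le_iff₀ h0]
    have : (0 : ℝ) ≤ q := q.cast_nonneg
    nlinarith
  have h3 := hb.trans this
  calc _ ≤ ‖s‖ * (4 * (q + 1)) := mul_le_mul_of_nonneg_left h3 (norm_nonneg _)
    _ ≤ _ := by
      have : (0 : ℝ) ≤ q := q.cast_nonneg
      nlinarith [norm_nonneg s]

/-- The terms from `n = 2` on are dominated by those of `ζ(2) - 1 = π²/6 - 1`. This keeps `|L|`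
between `1/4` and `2` far to the right. -/
theorem norm_LFunction_sub_one_le (χ : DirichletCharacter ℂ q) {s : ℂ} (hs : 2 ≤ s.re) :
    ‖LFunction χ s - 1‖ ≤ 3 / 4 := by
  have hs1 : 1 < s.re := by linarith
  have hsum : LSeriesSummable (fun n => χ (n : ZMod q)) s := (LSeriesSummable_iff (NeZero.ne q) χ).2 hs1
  have h2 : HasSum (fun n : ℕ => 1 / ((n : ℝ) ^ 2)) (Real.pi ^ 2 / 6) := hasSum_zeta_two
  have h3 : HasSum (fun n : ℕ => 1 / (((n + 2 : ℕ) : ℝ) ^ 2)) (Real.pi ^ 2 / 6 - 1) := by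
    have := (hasSum_nat_add_iff' 2).2 h2
    simpa [Finset.sum_range_succ] using this
  rw [LFunction_eq_LSeries χ hs1, LSeries, ← Summable.sum_add_tsum_nat_add 2 hsum]
  have e : ∑ i ∈ Finset.range 2, LSeries.term (fun n => χ (n : ZMod q)) s i = 1 := by
    simp [Finset.sum_range_succ]
  rw [e, add_sub_cancel_left]
  refine (tsum_of_norm_bounded h3 fun n => ?_).trans ?_
  · rw [LSeries.norm_term_eq, if_neg (by omega)]
    have hn : (1 : ℝ) ≤ ((n + 2 : ℕ) : ℝ) := by push_cast; linarith [n.cast_nonneg (α := ℝ)]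
    refine div_le_div₀ zero_le_one (χ.norm_le_one _) (by positivity) ?_
    rw [← Real.rpow_natCast]
    exact Real.rpow_le_rpow_of_exponent_le hn (by simpa using hs)
  · nlinarith [Real.pi_lt_d2, Real.pi_pos]

theorem le_norm_LFunction (χ : DirichletCharacter ℂ q) {s : ℂ} (hs : 2 ≤ s.re) :
    1 / 4 ≤ ‖LFunction χ s‖ := by
  have h := norm_LFunction_sub_one_le χ hs
  have h2 := norm_sub_norm_le (1 : ℂ) (LFunction χ s)
  rw [norm_sub_rev, norm_one] at h2
  linarith

theorem norm_LFunction_le_two (χ : DirichletCharacter ℂ q) {s : ℂ} (hs : 2 ≤ s.re) :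
    ‖LFunction χ s‖ ≤ 2 := by
  have h := norm_LFunction_sub_one_le χ hs
  have h2 := norm_sub_norm_le (LFunction χ s) (1 : ℂ)
  rw [norm_one] at h2
  linarith

end

/-! ### Zero-free functions on a disc: Borel–Carathéodory. -/

section

/-- A zero-free holomorphic function on a disc has a holomorphic logarithm. -/
theorem exists_log_on_ball {f : ℂ → ℂ} {c : ℂ} {R : ℝ} (hR : 0 < R)
    (hf : DifferentiableOn ℂ f (Metric.ball c R)) (hf0 : ∀ z ∈ Metric.ball c R, f z ≠ 0) :
    ∃ G : ℂ → ℂ, G c = 0 ∧ (∀ z ∈ Metric.ball c R, HasDerivAt G (logDeriv f z) z) ∧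
      ∀ z ∈ Metric.ball c R, f z = f c * Complex.exp (G z) := by
  have ho : IsOpen (Metric.ball c R) := Metric.isOpen_ball
  have hl : DifferentiableOn ℂ (logDeriv f) (Metric.ball c R) := (hf.deriv ho).div hf hf0
  obtain ⟨G, hG0, hG⟩ := hl.isExactOn_ball.with_val_at c 0
  refine ⟨G, hG0, hG, fun z hz => ?_⟩
  have hc : c ∈ Metric.ball c R := Metric.mem_ball_self hR
  have hd : ∀ w ∈ Metric.ball c R, HasDerivAt (fun w => f w * Complex.exp (-G w)) 0 w := by
    intro w hw
    have h1 := ((hf.differentiableAt (ho.mem_nhds hw)).hasDerivAt).mul ((hG w hw).neg.cexp)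
    have e : deriv f w * Complex.exp ((-G) w) + f w * (Complex.exp ((-G) w) * -logDeriv f w) = 0 := by
      rw [logDeriv_apply]
      field_simp [hf0 w hw]
      ring
    rw [e] at h1
    exact h1
  have hconst := (convex_ball c R).is_const_of_fderivWithin_eq_zero (𝕜 := ℂ)
    (f := fun w => f w * Complex.exp (-G w))
    (fun w hw => (hd w hw).differentiableAt.differentiableWithinAt)
    (fun w hw => by
      rw [fderivWithin_of_isOpen ho hw]
      ext; simp [(hd w hw).deriv]) hz hc
  simp only [hG0, neg_zero, Complex.exp_zero, mul_one] at hconst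
  rw [← hconst, mul_assoc, ← Complex.exp_add]; simp

/-- Lower bound and logarithmic derivative bound for zero-free functions, from Borel–Carathéodory. -/
theorem norm_logDeriv_le_of_ball {f : ℂ → ℂ} {c : ℂ} {R r M : ℝ} (hM : 0 < M) (hr : 0 ≤ r)
    (hrR : r < R) (hf : DifferentiableOn ℂ f (Metric.ball c R))
    (hf0 : ∀ z ∈ Metric.ball c R, f z ≠ 0)
    (hfM : ∀ z ∈ Metric.ball c R, ‖f z‖ ≤ Real.exp M * ‖f c‖) {z : ℂ} (hz : dist z c ≤ r) :
    ‖f c‖ * Real.exp (-(4 * M * R / (R - r))) ≤ ‖f z‖ ∧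
      ‖logDeriv f z‖ ≤ 8 * M * R / (R - r) ^ 2 := by
  have hR : 0 < R := by linarith
  obtain ⟨G, hG0, hG, hfG⟩ := exists_log_on_ball hR hf hf0
  have hc : c ∈ Metric.ball c R := Metric.mem_ball_self hR
  have hre : ∀ w ∈ Metric.ball c R, (G w).re ≤ M := by
    intro w hw
    have h1 := hfM w hw
    rw [hfG w hw, norm_mul, mul_comm, Complex.norm_exp] at h1
    exact Real.exp_le_exp.1 (le_of_mul_le_mul_right h1 (norm_pos_iff.2 (hf0 c hc)))
  have hmap : ∀ w : ℂ, w ∈ Metric.ball (0 : ℂ) R → w + c ∈ Metric.ball c R := by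
    intro w hw; simpa [dist_eq_norm] using hw
  -- Borel–Carathéodory is applied at the intermediate radius, which leaves room `(R - r) / 2` for
  -- Cauchy's estimate of the derivative.
  set r' := (R + r) / 2 with hr'
  have hBC : ∀ w, dist w c ≤ r' → ‖G w‖ ≤ 4 * M * R / (R - r) := by
    intro w hw
    have hw' : ‖w - c‖ ≤ r' := by rwa [← dist_eq_norm]
    have := Complex.borelCaratheodory_zero (f := fun w => G (w + c)) (z := w - c) hM
      (fun w hw => ((hG _ (hmap w hw)).comp_add_const w c).differentiableAt.differentiableWithinAt)
      (fun w hw => hre _ (hmap w hw)) hR (by rw [mem_ball_zero_iff]; linarith) (by simpa using hG0)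
    simp only [sub_add_cancel] at this
    refine this.trans ?_
    have e : 4 * M * R / (R - r) = 2 * M * R / ((R - r) / 2) := by
      have : R - r ≠ 0 := by linarith
      field_simp; ring
    rw [e]
    refine div_le_div₀ (by positivity) ?_ (by linarith) (by linarith)
    exact mul_le_mul_of_nonneg_left (by linarith) (by positivity)
  have hzb : z ∈ Metric.ball c R := Metric.mem_ball.2 (by linarith)
  constructor
  · rw [hfG z hzb, norm_mul, Complex.norm_exp]
    refine mul_le_mul_of_nonneg_left (Real.exp_le_exp.2 ?_) (norm_nonneg _)
    have h1 := hBC z (by linarith)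
    have h2 := Complex.abs_re_le_norm (G z)
    have h3 := neg_abs_le (G z).re
    linarith
  · rw [← (hG z hzb).deriv]
    have hsub : ∀ w ∈ Metric.closedBall z ((R - r) / 2), dist w c ≤ r' := by
      intro w hw
      have := dist_triangle w z c
      rw [Metric.mem_closedBall] at hw
      linarith
    have := Complex.norm_deriv_le_of_forall_mem_sphere_norm_le (f := G) (c := z)
      (R := (R - r) / 2) (C := 4 * M * R / (R - r)) (by linarith) ?_
      (fun w hw => hBC w (hsub w (Metric.sphere_subset_closedBall hw)))
    · refine this.trans (le_of_eq ?_)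
      have : R - r ≠ 0 := by linarith
      field_simp; ring
    · refine DifferentiableOn.diffContOnCl (s := Metric.ball z ((R - r) / 2)) fun w hw => ?_
      have hw2 := hsub w (Metric.closure_ball_subset_closedBall hw)
      exact (hG w (Metric.mem_ball.2 (by linarith))).differentiableAt.differentiableWithinAt

end

/-! ### Lower bound for `L` and upper bound for `L'/L` to the right of the critical line. -/

section
open DirichletCharacter

variable {q : ℕ} [NeZero q]

/-- Borel–Carathéodory on a disc inside `Re s > 1/2`, where `L` grows at most linearly and has no
zeros. Square-root growth is far from sharp, but it is integrable against a weight decaying like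
`|y|^(-2)` and leaves `1/L` of exponential type. -/
theorem LFunction_bounds_right (χ : DirichletCharacter ℂ q) (hχ : χ ≠ 1)
    (hz : ∀ s : ℂ, 1 / 2 < s.re → LFunction χ s ≠ 0) {h : ℝ} (hh : 0 < h) (hh1 : h < 1) :
    ∃ K : ℝ, 0 < K ∧ ∀ s : ℂ, 1 / 2 + h ≤ s.re →
      Real.exp (-(K * (1 + ‖s‖) ^ (1 / 2 : ℝ))) ≤ ‖LFunction χ s‖ ∧
      ‖logDeriv (LFunction χ) s‖ ≤ K * (1 + ‖s‖) ^ (1 / 2 : ℝ) := by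
  have hq : (0 : ℝ) < q := by exact_mod_cast NeZero.pos q
  set A : ℝ := 16 * (q + 1) * 5 with hA
  have hA0 : 0 < A := by positivity
  set K0 : ℝ := 2 * A ^ (1 / 2 : ℝ) with hK0
  have hK0p : 0 < K0 := by positivity
  -- With `R = 3/2` and `R - r = h`, the terms `6 / h` and `12 / h ^ 2` are the constants of
  -- `norm_logDeriv_le_of_ball`; the `2` absorbs `‖L c‖ ≥ 1/4 ≥ exp (-2)`.
  refine ⟨K0 * (6 / h + 12 / h ^ 2) + 2, by positivity, fun s hs => ?_⟩
  -- The centre has the height of `s` and lies where `|L| ≥ 1/4`; radius `3/2` then keeps the disc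
  -- to the right of the critical line.
  set c : ℂ := ⟨max s.re 2, s.im⟩ with hc
  have hc2 : 2 ≤ c.re := le_max_right _ _
  have hcs : ‖c - s‖ ≤ 3 / 2 - h := by
    have : c - s = ((max s.re 2 - s.re : ℝ) : ℂ) := by
      apply Complex.ext <;> simp [hc]
    rw [this, Complex.norm_real, Real.norm_eq_abs, abs_of_nonneg (by linarith [le_max_left s.re 2])]
    rcases max_cases s.re 2 with ⟨h1, h2⟩ | ⟨h1, h2⟩ <;> rw [h1] <;> linarith
  have hcn : ‖c‖ ≤ ‖s‖ + 3 / 2 := by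
    have := norm_add_le (c - s) s
    rw [sub_add_cancel] at this; linarith
  have hball : ∀ w ∈ Metric.ball c (3 / 2), 1 / 2 < w.re := by
    intro w hw
    rw [Metric.mem_ball, dist_eq_norm] at hw
    have := Complex.abs_re_le_norm (w - c)
    rw [Complex.sub_re] at this
    have := neg_abs_le (w.re - c.re)
    linarith
  have hn1 : (1 : ℝ) ≤ 1 + ‖s‖ := by linarith [norm_nonneg s]
  set M : ℝ := K0 * (1 + ‖s‖) ^ (1 / 2 : ℝ) with hM
  have hMp : 0 < M := by positivity
  -- The left side is `(M / 2) ^ 2` by the choice of `K0`, so the quadratic lower bound for `exp`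
  -- suffices.
  have hexp : A * (1 + ‖s‖) ≤ Real.exp M := by
    have h1 : A * (1 + ‖s‖) = ((A * (1 + ‖s‖)) ^ (1 / 2 : ℝ)) ^ 2 := by
      rw [← Real.rpow_natCast, ← Real.rpow_mul (by positivity)]; norm_num
    have h2 : (A * (1 + ‖s‖)) ^ (1 / 2 : ℝ) = M / 2 := by
      rw [Real.mul_rpow hA0.le (by linarith), hM, hK0]; ring
    rw [h1, h2]
    have h3 := Real.quadratic_le_exp_of_nonneg hMp.le
    nlinarith
  have key := norm_logDeriv_le_of_ball (f := LFunction χ) (c := c) (R := 3 / 2) (r := 3 / 2 - h)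
    (M := M) hMp (by linarith) (by linarith) (differentiable_LFunction hχ).differentiableOn
    (fun w hw => hz w (hball w hw)) ?_ (z := s) (by rw [dist_comm, dist_eq_norm]; exact hcs)
  · have hl := le_norm_LFunction χ hc2
    have e1 : (3 / 2 - (3 / 2 - h) : ℝ) = h := by ring
    rw [e1] at key
    have hMK : M ^ 1 = K0 * (1 + ‖s‖) ^ (1 / 2 : ℝ) := by rw [pow_one]
    constructor
    · refine le_trans ?_ key.1
      have h4 : (1 / 4 : ℝ) ≥ Real.exp (-2) := by
        rw [Real.exp_neg, ge_iff_le, inv_le_comm₀ (Real.exp_pos _) (by norm_num)]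
        have := Real.quadratic_le_exp_of_nonneg (show (0 : ℝ) ≤ 2 by norm_num)
        norm_num at this ⊢; linarith
      calc _ ≤ Real.exp (-2) * Real.exp (-(4 * M * (3 / 2) / h)) := by
            rw [← Real.exp_add]
            refine Real.exp_le_exp.2 ?_
            have h5 : (1 : ℝ) ≤ (1 + ‖s‖) ^ (1 / 2 : ℝ) := Real.one_le_rpow hn1 (by norm_num)
            have h6 : 4 * M * (3 / 2) / h = K0 * (6 / h) * (1 + ‖s‖) ^ (1 / 2 : ℝ) := by
              rw [hM]; ring
            rw [h6]
            have h7 : 0 ≤ K0 * (12 / h ^ 2) * (1 + ‖s‖) ^ (1 / 2 : ℝ) := by positivity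
            nlinarith
        _ ≤ _ := mul_le_mul_of_nonneg_right (h4.le.trans hl) (Real.exp_pos _).le
    · refine key.2.trans ?_
      have h6 : 8 * M * (3 / 2) / h ^ 2 = K0 * (12 / h ^ 2) * (1 + ‖s‖) ^ (1 / 2 : ℝ) := by
        rw [hM]; ring
      rw [h6]
      have h7 : 0 ≤ (K0 * (6 / h) + 2) * (1 + ‖s‖) ^ (1 / 2 : ℝ) := by positivity
      nlinarith
  · intro w hw
    have h1 := norm_LFunction_le χ hχ (s := w) (by linarith [hball w hw])
    have hwn : ‖w‖ ≤ ‖s‖ + 3 := by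
      rw [Metric.mem_ball, dist_eq_norm] at hw
      have := norm_add_le (w - c) c
      rw [sub_add_cancel] at this; linarith
    have hl := le_norm_LFunction χ hc2
    have h2 : ‖LFunction χ w‖ ≤ A * (1 + ‖s‖) * (1 / 4) := by
      refine h1.trans ?_
      rw [hA]
      have : (0 : ℝ) ≤ ‖s‖ := norm_nonneg s
      nlinarith [mul_nonneg hq.le this]
    refine h2.trans ?_
    exact mul_le_mul hexp hl (by norm_num) (Real.exp_pos _).le

end

/-! ### Dividing out zeros, and bounds for quotients of gamma factors. -/

section

/-- An entire function is divisible by `(z - a) ^ m` if it vanishes to order at least `m` at `a`. -/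
theorem exists_eq_pow_mul {f : ℂ → ℂ} (hf : Differentiable ℂ f) (a : ℂ) (m : ℕ)
    (hm : (m : ℕ∞) ≤ analyticOrderAt f a) :
    ∃ k : ℂ → ℂ, Differentiable ℂ k ∧ ∀ z, f z = (z - a) ^ m * k z := by
  induction m with
  | zero => exact ⟨f, hf, fun z => by simp⟩
  | succ m ih =>
    obtain ⟨k, hk, hfk⟩ := ih (le_trans (by exact_mod_cast Nat.le_succ m) hm)
    have hka : AnalyticAt ℂ k a := hk.analyticAt a
    have hpa : AnalyticAt ℂ (fun z : ℂ => (z - a) ^ m) a := by fun_prop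
    have ho : analyticOrderAt f a = m + analyticOrderAt k a := by
      have : f = (fun z : ℂ => (z - a) ^ m) * k := funext hfk
      rw [this, analyticOrderAt_mul hpa hka]
      congr 1
      exact hpa.analyticOrderAt_eq_natCast.2 ⟨1, analyticAt_const, one_ne_zero, by simp⟩
    have hk0 : k a = 0 := by
      by_contra h
      rw [hka.analyticOrderAt_eq_zero.2 h, add_zero] at ho
      rw [ho] at hm
      have : m + 1 ≤ m := by exact_mod_cast hm
      omega
    refine ⟨dslope k a, ?_, fun z => ?_⟩
    · rw [← differentiableOn_univ, Complex.differentiableOn_dslope Filter.univ_mem,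
        differentiableOn_univ]
      exact hk
    · have h := sub_smul_dslope k a z
      rw [hk0, sub_zero, smul_eq_mul] at h
      rw [hfk z, ← h]; ring

theorem exists_eq_pow_mul_pow_mul {f : ℂ → ℂ} (hf : Differentiable ℂ f) {a b : ℂ} (hab : a ≠ b)
    (m n : ℕ) (hm : (m : ℕ∞) ≤ analyticOrderAt f a) (hn : (n : ℕ∞) ≤ analyticOrderAt f b) :
    ∃ k : ℂ → ℂ, Differentiable ℂ k ∧ ∀ z, f z = (z - a) ^ m * (z - b) ^ n * k z := by
  obtain ⟨k, hk, hfk⟩ := exists_eq_pow_mul hf a m hm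
  have hpb : AnalyticAt ℂ (fun z : ℂ => (z - a) ^ m) b := by fun_prop
  have ho : analyticOrderAt f b = analyticOrderAt k b := by
    have : f = (fun z : ℂ => (z - a) ^ m) * k := funext hfk
    rw [this, analyticOrderAt_mul hpb (hk.analyticAt b), hpb.analyticOrderAt_eq_zero.2, zero_add]
    exact pow_ne_zero _ (sub_ne_zero.2 hab.symm)
  rw [ho] at hn
  obtain ⟨l, hl, hkl⟩ := exists_eq_pow_mul hk b n hn
  exact ⟨l, hl, fun z => by rw [hfk, hkl]; ring⟩

theorem norm_betaIntegral_le {z : ℂ} {a h : ℝ} (ha : 0 < a) (hh : 0 < h) (hz : a ≤ z.re) :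
    ‖Complex.betaIntegral z h‖ ≤ ∫ x in (0 : ℝ)..1, x ^ (a - 1) * (1 - x) ^ (h - 1) := by
  have hint : IntervalIntegrable (fun x : ℝ => x ^ (a - 1) * (1 - x) ^ (h - 1)) volume 0 1 := by
    have := (Complex.betaIntegral_convergent (u := a) (v := h) (by simpa) (by simpa)).norm
    refine this.congr_uIoo fun x hx => ?_
    rw [Set.uIoo_of_le zero_le_one] at hx
    have h1 : (1 : ℂ) - (x : ℂ) = ((1 - x : ℝ) : ℂ) := by simp
    simp only
    rw [norm_mul, h1, Complex.norm_cpow_eq_rpow_re_of_pos hx.1,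
      Complex.norm_cpow_eq_rpow_re_of_pos (by linarith [hx.2])]
    simp
  rw [Complex.betaIntegral]
  refine intervalIntegral.norm_integral_le_of_norm_le zero_le_one ?_ hint
  filter_upwards [compl_mem_ae_iff.2 (measure_singleton (1 : ℝ))] with x hx1 hx
  have hx2 : x < 1 := lt_of_le_of_ne hx.2 hx1
  have h1 : (1 : ℂ) - (x : ℂ) = ((1 - x : ℝ) : ℂ) := by simp
  rw [norm_mul, h1, Complex.norm_cpow_eq_rpow_re_of_pos hx.1,
    Complex.norm_cpow_eq_rpow_re_of_pos (by linarith)]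
  have e1 : ((h : ℂ) - 1).re = h - 1 := by simp
  have e2 : (z - 1).re = z.re - 1 := by simp
  rw [e1, e2]
  refine mul_le_mul_of_nonneg_right ?_ (Real.rpow_nonneg (by linarith) _)
  exact Real.rpow_le_rpow_of_exponent_ge hx.1 hx.2 (by linarith)

/-- The quotient is `B(z, h) / Γ(h)`, and the absolute value of the beta integrand depends on `z`
only through `Re z`. This takes the place of Stirling's formula. -/
theorem exists_norm_Gamma_div_le {a h : ℝ} (ha : 0 < a) (hh : 0 < h) :
    ∃ C : ℝ, 0 ≤ C ∧ ∀ z : ℂ, a ≤ z.re → ‖Complex.Gamma z / Complex.Gamma (z + h)‖ ≤ C := by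
  refine ⟨(∫ x in (0 : ℝ)..1, x ^ (a - 1) * (1 - x) ^ (h - 1)) / ‖Complex.Gamma h‖, ?_, fun z hz => ?_⟩
  · exact div_nonneg ((norm_nonneg _).trans (norm_betaIntegral_le (z := a) ha hh (by simp)))
      (norm_nonneg _)
  · have hG : Complex.Gamma h ≠ 0 := Complex.Gamma_ne_zero_of_re_pos (by simpa)
    have e : Complex.Gamma z / Complex.Gamma (z + h) = Complex.betaIntegral z h / Complex.Gamma h := by
      rw [Complex.betaIntegral_eq_Gamma_mul_div z h (by linarith) (by simpa)]
      field_simp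
    rw [e, norm_div]
    exact div_le_div_of_nonneg_right (norm_betaIntegral_le ha hh hz) (norm_nonneg _)

theorem exists_norm_Gammaℝ_div_le {a h : ℝ} (ha : 0 < a) (hh : 0 < h) :
    ∃ C : ℝ, 0 ≤ C ∧ ∀ z : ℂ, a ≤ z.re →
      ‖Complex.Gammaℝ z / Complex.Gammaℝ (z + h)‖ ≤ C := by
  obtain ⟨C, hC, hb⟩ := exists_norm_Gamma_div_le (a := a / 2) (h := h / 2) (by linarith) (by linarith)
  refine ⟨Real.pi ^ (h / 2) * C, by positivity, fun z hz => ?_⟩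
  have hpi : (Real.pi : ℂ) ≠ 0 := by exact_mod_cast Real.pi_ne_zero
  have e : Complex.Gammaℝ z / Complex.Gammaℝ (z + h) =
      (Real.pi : ℂ) ^ ((h / 2 : ℝ) : ℂ) *
        (Complex.Gamma (z / 2) / Complex.Gamma (z / 2 + (h / 2 : ℝ))) := by
    rw [Complex.Gammaℝ_def, Complex.Gammaℝ_def, mul_div_mul_comm, ← Complex.cpow_sub _ _ hpi]
    congr 2
    · push_cast; ring
    · congr 2
      push_cast; ring
  rw [e, norm_mul, Complex.norm_cpow_eq_rpow_re_of_pos Real.pi_pos, Complex.ofReal_re]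
  refine mul_le_mul_of_nonneg_left (hb _ ?_) (by positivity)
  simpa using by linarith

theorem exists_norm_gammaFactor_div_le {q : ℕ} (χ : DirichletCharacter ℂ q) {a h : ℝ} (ha : 0 < a)
    (hh : 0 < h) : ∃ C : ℝ, 0 ≤ C ∧ ∀ z : ℂ, a ≤ z.re →
      ‖χ.gammaFactor z / χ.gammaFactor (z + h)‖ ≤ C := by
  obtain ⟨C, hC, hb⟩ := exists_norm_Gammaℝ_div_le ha hh
  refine ⟨C, hC, fun z hz => ?_⟩
  rw [DirichletCharacter.gammaFactor, DirichletCharacter.gammaFactor]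
  split_ifs
  · exact hb z hz
  · rw [add_right_comm]; exact hb _ (by simp; linarith)

theorem differentiableAt_Gammaℝ {s : ℂ} (hs : 0 < s.re) : DifferentiableAt ℂ Complex.Gammaℝ s := by
  have h := (Complex.differentiable_Gammaℝ_inv s).inv (inv_ne_zero (Complex.Gammaℝ_ne_zero_of_re_pos hs))
  have e : (fun s => (Complex.Gammaℝ s)⁻¹)⁻¹ = Complex.Gammaℝ := by ext; simp
  rwa [e] at h

theorem differentiableAt_gammaFactor {q : ℕ} (χ : DirichletCharacter ℂ q) {s : ℂ} (hs : 0 < s.re) :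
    DifferentiableAt ℂ χ.gammaFactor s := by
  rcases χ.even_or_odd with he | ho
  · rw [funext he.gammaFactor_def]; exact differentiableAt_Gammaℝ hs
  · rw [funext ho.gammaFactor_def]
    have h1 : 0 < (s + 1).re := by simp; linarith
    exact ((differentiableAt_Gammaℝ h1).hasDerivAt.comp_add_const s 1).differentiableAt

end

/-! ### The completed cofactor and Phragmén–Lindelöf. -/

section
open DirichletCharacter

/-- The completed factor `q ^ (s / 2) γ(s) k(s)`. -/
noncomputable def xiFactor {q : ℕ} (χ : DirichletCharacter ℂ q) (k : ℂ → ℂ) (s : ℂ) : ℂ :=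
  (q : ℂ) ^ (s / 2) * χ.gammaFactor s * k s

variable {q : ℕ} [NeZero q] (χ : DirichletCharacter ℂ q)

theorem differentiableAt_xiFactor {k : ℂ → ℂ} (hk : Differentiable ℂ k) {s : ℂ} (hs : 0 < s.re) :
    DifferentiableAt ℂ (xiFactor χ k) s := by
  have h1 : DifferentiableAt ℂ (fun s : ℂ => (q : ℂ) ^ (s / 2)) s :=
    DifferentiableAt.const_cpow (by fun_prop) (Or.inl (NeZero.ne _))
  exact (h1.mul (differentiableAt_gammaFactor χ hs)).mul (hk s)

theorem xiFactor_ne_zero {k : ℂ → ℂ} {s : ℂ} (hs : 0 < s.re) (hk : k s ≠ 0) :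
    xiFactor χ k s ≠ 0 :=
  mul_ne_zero (mul_ne_zero (by simp [Complex.cpow_eq_zero_iff, NeZero.ne q])
    (gammaFactor_ne_zero χ hs)) hk

theorem norm_xiFactor_div {k : ℂ → ℂ} (z : ℂ) (h : ℝ) :
    ‖xiFactor χ k z / xiFactor χ k (z + h)‖ = (q : ℝ) ^ (-(h / 2)) *
      ‖χ.gammaFactor z / χ.gammaFactor (z + h)‖ * (‖k z‖ / ‖k (z + h)‖) := by
  have hq : (0 : ℝ) < q := by exact_mod_cast NeZero.pos q
  have e : (q : ℝ) ^ (-(h / 2)) = ‖(q : ℂ) ^ (z / 2)‖ / ‖(q : ℂ) ^ ((z + h) / 2)‖ := by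
    rw [Complex.norm_natCast_cpow_of_pos (NeZero.pos q), Complex.norm_natCast_cpow_of_pos (NeZero.pos q),
      ← Real.rpow_sub hq]
    congr 1
    simp; ring
  rw [e, xiFactor, xiFactor, norm_div, norm_mul, norm_mul, norm_mul, norm_mul, norm_div]
  field_simp

variable {χ}

theorem norm_sub_point_eq (γ y h : ℝ) :
    ‖(1 / 2 + Complex.I * y - h : ℂ) - (1 / 2 + Complex.I * γ)‖ =
      ‖(1 / 2 + Complex.I * y + h : ℂ) - (1 / 2 + Complex.I * γ)‖ := by
  have e1 : (1 / 2 + Complex.I * y - h : ℂ) - (1 / 2 + Complex.I * γ) =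
      -conj ((1 / 2 + Complex.I * y + h : ℂ) - (1 / 2 + Complex.I * γ)) := by
    simp
    ring
  rw [e1, norm_neg, RCLike.norm_conj]

/-- Reflection in the critical line preserves distances to points on it, so the linear factors
cancel from the functional equation; `q ^ (s / 2)` absorbs its power of `q`. -/
theorem xiFactor_norm_eq_on_line (hχ : χ ≠ 1) (hp : χ.IsPrimitive)
    (hz : ∀ s : ℂ, 1 / 2 < s.re → LFunction χ s ≠ 0) {k : ℂ → ℂ} {γ₁ γ₂ : ℝ} {m n : ℕ}
    (hk : ∀ s, LFunction χ s = (s - (1 / 2 + Complex.I * γ₁)) ^ m *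
      (s - (1 / 2 + Complex.I * γ₂)) ^ n * k s) {h : ℝ} (h0 : 0 < h) (h1 : h < 1 / 4) (y : ℝ) :
    ‖xiFactor χ k (1 / 2 + Complex.I * y - h)‖ = ‖xiFactor χ k (1 / 2 + Complex.I * y + h)‖ := by
  have hq : (0 : ℝ) < q := by exact_mod_cast NeZero.pos q
  set w : ℂ := 1 / 2 + Complex.I * y + h with hw
  set w' : ℂ := 1 / 2 + Complex.I * y - h with hw'
  have hwre : w.re = 1 / 2 + h := by simp [hw]
  have hwre' : w'.re = 1 / 2 - h := by simp [hw']
  have hww : w' = 1 - conj w := by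
    apply Complex.ext
    · simp [hw, hw']; ring
    · simp [hw, hw']
  have hFE := norm_functional_equation χ hχ hp hz (s := w) (by linarith) (by linarith)
  rw [← hww] at hFE
  have hne : ∀ γ : ℝ, w - (1 / 2 + Complex.I * γ) ≠ 0 := by
    intro γ e
    have := congrArg Complex.re e
    simp [hw] at this
    exact h0.ne' this
  rw [hk w, hk w', norm_mul, norm_mul, norm_mul, norm_mul, norm_mul, norm_mul, norm_pow, norm_pow,
    norm_pow, norm_pow, norm_sub_point_eq, norm_sub_point_eq] at hFE
  have p1 : 0 < ‖w - (1 / 2 + Complex.I * γ₁)‖ ^ m := pow_pos (norm_pos_iff.2 (hne _)) _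
  have p2 : 0 < ‖w - (1 / 2 + Complex.I * γ₂)‖ ^ n := pow_pos (norm_pos_iff.2 (hne _)) _
  have hFE2 : ‖χ.gammaFactor w'‖ * ‖k w'‖ = (q : ℝ) ^ (w.re - 1 / 2) * (‖χ.gammaFactor w‖ * ‖k w‖) := by
    apply mul_left_cancel₀ (mul_pos p1 p2).ne'
    linear_combination hFE
  rw [xiFactor, xiFactor, norm_mul, norm_mul, norm_mul, norm_mul, mul_assoc, mul_assoc, hFE2,
    Complex.norm_natCast_cpow_of_pos (NeZero.pos q), Complex.norm_natCast_cpow_of_pos (NeZero.pos q),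
    ← mul_assoc, ← Real.rpow_add hq]
  congr 2
  have e1 : (w' / 2).re = w'.re / 2 := by simp
  have e2 : (w / 2).re = w.re / 2 := by simp
  rw [e1, e2, hwre, hwre']; ring

/-- The quotient of an `L`-function by finitely many linear factors still grows at most linearly. -/
theorem quotient_norm_le (hχ : χ ≠ 1) {k : ℂ → ℂ} (hkd : Differentiable ℂ k) {a b : ℂ} {m n : ℕ}
    (hk : ∀ s, LFunction χ s = (s - a) ^ m * (s - b) ^ n * k s) :
    ∃ B : ℝ, 0 < B ∧ ∀ s : ℂ, 1 / 4 ≤ s.re → ‖k s‖ ≤ B * (1 + ‖s‖) := by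
  -- Outside this ball both linear factors have modulus at least `1`, so `‖k s‖ ≤ ‖LFunction χ s‖`;
  -- inside, compactness is enough.
  obtain ⟨B, hB⟩ := (isCompact_closedBall (0 : ℂ) (1 + ‖a‖ + ‖b‖)).exists_bound_of_continuousOn
    hkd.continuous.continuousOn
  refine ⟨|B| + 4 * (q + 1), by positivity, fun s hs => ?_⟩
  have hq : (0 : ℝ) ≤ q := q.cast_nonneg
  by_cases hsb : ‖s‖ ≤ 1 + ‖a‖ + ‖b‖
  · have h1 := (hB s (by simpa using hsb)).trans (le_abs_self B)
    nlinarith [norm_nonneg s, abs_nonneg B, mul_nonneg hq (norm_nonneg s),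
      mul_nonneg (abs_nonneg B) (norm_nonneg s)]
  · push Not at hsb
    have h1 : 1 ≤ ‖s - a‖ := by
      have := norm_sub_norm_le s a
      linarith [norm_nonneg b]
    have h2 : 1 ≤ ‖s - b‖ := by
      have := norm_sub_norm_le s b
      linarith [norm_nonneg a]
    have h3 : ‖k s‖ ≤ ‖LFunction χ s‖ := by
      rw [hk s, norm_mul, norm_mul, norm_pow, norm_pow]
      exact le_mul_of_one_le_left (norm_nonneg _)
        (one_le_mul_of_one_le_of_one_le (one_le_pow₀ h1) (one_le_pow₀ h2))
    refine h3.trans ((norm_LFunction_le χ hχ hs).trans ?_)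
    nlinarith [norm_nonneg s, abs_nonneg B, mul_nonneg (abs_nonneg B) (norm_nonneg s)]

/-- Supplies the exponential-type bound on the denominator of `ξ(s - h) / ξ(s + h)` that
Phragmén–Lindelöf requires. -/
theorem inv_quotient_norm_le (hχ : χ ≠ 1) (hz : ∀ s : ℂ, 1 / 2 < s.re → LFunction χ s ≠ 0)
    {k : ℂ → ℂ} {a b : ℂ} {m n : ℕ}
    (hk : ∀ s, LFunction χ s = (s - a) ^ m * (s - b) ^ n * k s) {h : ℝ} (h0 : 0 < h) (h1 : h < 1) :
    ∃ B : ℝ, 0 < B ∧ ∀ s : ℂ, 1 / 2 + h ≤ s.re → ‖k s‖⁻¹ ≤ Real.exp (B * (1 + ‖s‖)) := by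
  obtain ⟨K, hK, hb⟩ := LFunction_bounds_right χ hχ hz h0 h1
  refine ⟨K + m * (1 + ‖a‖) + n * (1 + ‖b‖), by positivity, fun s hs => ?_⟩
  have hL := (hb s hs).1
  have hLp : 0 < ‖LFunction χ s‖ := (Real.exp_pos _).trans_le hL
  have hkne : ‖k s‖ ≠ 0 := by
    intro h
    rw [hk s, norm_mul, h, mul_zero] at hLp
    exact hLp.false
  have e : ‖k s‖⁻¹ = ‖s - a‖ ^ m * ‖s - b‖ ^ n * ‖LFunction χ s‖⁻¹ := by
    rw [hk s, norm_mul, norm_mul, norm_pow, norm_pow] at hLp ⊢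
    have h2 : ‖s - a‖ ^ m * ‖s - b‖ ^ n ≠ 0 := by
      intro h; rw [h, zero_mul] at hLp; exact hLp.false
    field_simp
    rw [div_self h2]
  have hpow : ∀ (c : ℂ) (j : ℕ), ‖s - c‖ ^ j ≤ Real.exp (j * (1 + ‖c‖) * (1 + ‖s‖)) := by
    intro c j
    have h2 : ‖s - c‖ ≤ Real.exp ((1 + ‖c‖) * (1 + ‖s‖)) := by
      have h3 := Real.add_one_le_exp ((1 + ‖c‖) * (1 + ‖s‖))
      have h4 := norm_sub_le s c
      nlinarith [norm_nonneg s, norm_nonneg c, mul_nonneg (norm_nonneg s) (norm_nonneg c)]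
    calc ‖s - c‖ ^ j ≤ Real.exp ((1 + ‖c‖) * (1 + ‖s‖)) ^ j := pow_le_pow_left₀ (norm_nonneg _) h2 j
      _ = _ := by rw [← Real.exp_nat_mul]; ring_nf
  have hinv : ‖LFunction χ s‖⁻¹ ≤ Real.exp (K * (1 + ‖s‖)) := by
    rw [inv_le_comm₀ hLp (Real.exp_pos _), ← Real.exp_neg]
    refine le_trans (Real.exp_le_exp.2 ?_) hL
    have : (1 + ‖s‖) ^ (1 / 2 : ℝ) ≤ (1 + ‖s‖) ^ (1 : ℝ) :=
      Real.rpow_le_rpow_of_exponent_le (by linarith [norm_nonneg s]) (by norm_num)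
    rw [Real.rpow_one] at this
    nlinarith
  rw [e]
  calc _ ≤ Real.exp (m * (1 + ‖a‖) * (1 + ‖s‖)) * Real.exp (n * (1 + ‖b‖) * (1 + ‖s‖)) *
        Real.exp (K * (1 + ‖s‖)) := by
        have := hpow a m
        have := hpow b n
        gcongr
    _ = _ := by rw [← Real.exp_add, ← Real.exp_add]; ring_nf

/-- Phragmén–Lindelöf: `|ξ(z - h)| ≤ |ξ(z + h)|` to the right of the critical line. -/
theorem norm_xiFactor_div_le_one (hχ : χ ≠ 1) (hp : χ.IsPrimitive)
    (hz : ∀ s : ℂ, 1 / 2 < s.re → LFunction χ s ≠ 0) {k : ℂ → ℂ} (hkd : Differentiable ℂ k)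
    {γ₁ γ₂ : ℝ} {m n : ℕ}
    (hk : ∀ s, LFunction χ s = (s - (1 / 2 + Complex.I * γ₁)) ^ m *
      (s - (1 / 2 + Complex.I * γ₂)) ^ n * k s) {h : ℝ} (h0 : 0 < h) (h1 : h < 1 / 4) {s : ℂ}
    (hs : 1 / 2 ≤ s.re) :
    ‖xiFactor χ k (s - h) / xiFactor χ k (s + h)‖ ≤ 1 := by
  have hq : (1 : ℝ) ≤ q := by exact_mod_cast NeZero.pos q
  have hk0 : ∀ s : ℂ, 1 / 2 < s.re → k s ≠ 0 := by
    intro s hs h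
    exact hz s hs (by rw [hk s, h, mul_zero])
  obtain ⟨Cg, hCg, hg⟩ := exists_norm_gammaFactor_div_le χ (a := 1 / 4) (h := 2 * h) (by norm_num)
    (by linarith)
  obtain ⟨B, hB, hkB⟩ := quotient_norm_le hχ hkd hk
  obtain ⟨B', hB', hkB'⟩ := inv_quotient_norm_le hχ hz hk h0 (by linarith)
  -- Coordinates in which the critical line is the imaginary axis. Since `h < 1/4`, the numerator
  -- stays in `Re ≥ 1/4`, where the growth bounds hold; the denominator stays in the zero-free
  -- region.
  set f : ℂ → ℂ := fun z => xiFactor χ k (1 / 2 + z - h) / xiFactor χ k (1 / 2 + z + h) with hf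
  have hfn : ∀ z : ℂ, 0 ≤ z.re → ‖f z‖ ≤ Cg * (‖k (1 / 2 + z - h)‖ / ‖k (1 / 2 + z + h)‖) := by
    intro z hz
    have e : (1 / 2 + z + h : ℂ) = (1 / 2 + z - h) + ((2 * h : ℝ) : ℂ) := by push_cast; ring
    have hr : (1 / 4 : ℝ) ≤ (1 / 2 + z - h).re := by simp; linarith
    simp only [hf]
    rw [e, norm_xiFactor_div]
    have h2 : (q : ℝ) ^ (-(2 * h / 2)) ≤ 1 := Real.rpow_le_one_of_one_le_of_nonpos hq (by linarith)
    refine mul_le_mul_of_nonneg_right ?_ (by positivity)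
    calc _ ≤ 1 * Cg := mul_le_mul h2 (hg _ hr) (norm_nonneg _) zero_le_one
      _ = Cg := one_mul _
  have hfd : ∀ z : ℂ, 0 ≤ z.re → DifferentiableAt ℂ f z := by
    intro z hz
    have r1 : 0 < (1 / 2 + z - h).re := by simp; linarith
    have r2 : 1 / 2 < (1 / 2 + z + h).re := by simp; linarith
    refine DifferentiableAt.div ?_ ?_ (xiFactor_ne_zero χ (by linarith) (hk0 _ r2))
    · exact DifferentiableAt.comp (g := xiFactor χ k) (f := fun z : ℂ => 1 / 2 + z - h) z
        (differentiableAt_xiFactor χ hkd r1) (by fun_prop)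
    · exact DifferentiableAt.comp (g := xiFactor χ k) (f := fun z : ℂ => 1 / 2 + z + h) z
        (differentiableAt_xiFactor χ hkd (by linarith)) (by fun_prop)
  have hcl : closure {z : ℂ | 0 < z.re} = {z : ℂ | 0 ≤ z.re} := Complex.closure_setOfPred_lt_re 0
  have main := PhragmenLindelof.right_half_plane_of_bounded_on_real (f := f) (C := 1)
    (z := s - 1 / 2) ?_ ?_ ?_ ?_ (by simp; linarith)
  · simpa only [hf, add_sub_cancel] using main
  · refine DifferentiableOn.diffContOnCl fun z hz => ?_
    rw [hcl] at hz
    exact (hfd z hz).differentiableWithinAt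
  -- Growth of order `1`, below the critical order `2` of a half-plane.
  · refine ⟨1, by norm_num, 1 + B', ?_⟩
    refine Asymptotics.IsBigO.of_bound (Cg * B * 2 * Real.exp (B' * 2)) ?_
    rw [eventually_inf_principal]
    refine .of_forall fun z hz => (hfn z (le_of_lt hz)).trans ?_
    have hz0 : 0 < z.re := hz
    have r1 : (1 / 4 : ℝ) ≤ (1 / 2 + z - h).re := by simp; linarith
    have r2 : 1 / 2 + h ≤ (1 / 2 + z + h).re := by simp; linarith
    have nh : ‖(h : ℂ)‖ ≤ 1 / 2 := by
      rw [Complex.norm_real, Real.norm_eq_abs, abs_of_pos h0]; linarith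
    have nn : ‖(1 / 2 + z : ℂ)‖ ≤ 1 / 2 + ‖z‖ := (norm_add_le _ _).trans (by simp)
    have n1 : ‖(1 / 2 + z - h : ℂ)‖ ≤ 1 + ‖z‖ := (norm_sub_le _ _).trans (by linarith)
    have n2 : ‖(1 / 2 + z + h : ℂ)‖ ≤ 1 + ‖z‖ := (norm_add_le _ _).trans (by linarith)
    have k1 : ‖k (1 / 2 + z - h)‖ ≤ B * (2 * Real.exp ‖z‖) := by
      refine (hkB _ r1).trans (mul_le_mul_of_nonneg_left ?_ hB.le)
      have := Real.add_one_le_exp ‖z‖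
      linarith [norm_nonneg z]
    have k2 : ‖k (1 / 2 + z + h)‖⁻¹ ≤ Real.exp (B' * (2 + ‖z‖)) :=
      (hkB' _ r2).trans (Real.exp_le_exp.2 (mul_le_mul_of_nonneg_left (by linarith) hB'.le))
    rw [Real.norm_eq_abs, abs_of_pos (Real.exp_pos _), Real.rpow_one, div_eq_mul_inv]
    calc _ ≤ Cg * (B * (2 * Real.exp ‖z‖) * Real.exp (B' * (2 + ‖z‖))) := by gcongr
      _ = Cg * B * 2 * (Real.exp (B' * 2) * (Real.exp (B' * ‖z‖) * Real.exp ‖z‖)) := by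
        rw [mul_add, Real.exp_add]; ring
      _ = _ := by
        rw [← Real.exp_add (B' * ‖z‖)]; ring_nf
  -- Boundedness on the positive real axis: `8 = 2 / (1/4)` compares the bounds for `L` at the two
  -- points, and each linear factor at most doubles between them.
  · refine ⟨Cg * (8 * (2 ^ m * 2 ^ n)), ?_⟩
    rw [eventually_map]
    filter_upwards [eventually_ge_atTop 3] with x hx
    refine (hfn x (by simp; linarith)).trans (mul_le_mul_of_nonneg_left ?_ hCg)
    have r1 : (2 : ℝ) ≤ (1 / 2 + (x : ℂ) - h).re := by simp; linarith
    have r2 : (2 : ℝ) ≤ (1 / 2 + (x : ℂ) + h).re := by simp; linarith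
    have l1 := norm_LFunction_le_two χ r1
    have l2 := le_norm_LFunction χ r2
    have hlin : ∀ γ : ℝ, ‖(1 / 2 + (x : ℂ) + h) - (1 / 2 + Complex.I * γ)‖ ≤
        2 * ‖(1 / 2 + (x : ℂ) - h) - (1 / 2 + Complex.I * γ)‖ ∧
        0 < ‖(1 / 2 + (x : ℂ) - h) - (1 / 2 + Complex.I * γ)‖ := by
      intro γ
      have h3 : 1 ≤ ‖(1 / 2 + (x : ℂ) - h) - (1 / 2 + Complex.I * γ)‖ := by
        refine le_trans ?_ (Complex.re_le_norm _)
        simp; linarith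
      refine ⟨?_, by linarith⟩
      have e : (1 / 2 + (x : ℂ) + h) - (1 / 2 + Complex.I * γ) =
          ((1 / 2 + (x : ℂ) - h) - (1 / 2 + Complex.I * γ)) + ((2 * h : ℝ) : ℂ) := by push_cast; ring
      rw [e]
      refine (norm_add_le _ _).trans ?_
      rw [Complex.norm_real, Real.norm_eq_abs, abs_of_pos (by linarith)]
      linarith
    obtain ⟨a1, a2⟩ := hlin γ₁
    obtain ⟨b1, b2⟩ := hlin γ₂
    rw [hk, norm_mul, norm_mul, norm_pow, norm_pow] at l1 l2
    set u := ‖(1 / 2 + (x : ℂ) - h) - (1 / 2 + Complex.I * γ₁)‖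
    set v := ‖(1 / 2 + (x : ℂ) - h) - (1 / 2 + Complex.I * γ₂)‖
    set u' := ‖(1 / 2 + (x : ℂ) + h) - (1 / 2 + Complex.I * γ₁)‖
    set v' := ‖(1 / 2 + (x : ℂ) + h) - (1 / 2 + Complex.I * γ₂)‖
    have hkp : 0 < ‖k (1 / 2 + (x : ℂ) + h)‖ := norm_pos_iff.2 (hk0 _ (by linarith))
    rw [div_le_iff₀ hkp]
    have huv : 0 < u ^ m * v ^ n := by positivity
    have h4 : u' ^ m * v' ^ n ≤ (2 ^ m * 2 ^ n) * (u ^ m * v ^ n) := by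
      calc u' ^ m * v' ^ n ≤ (2 * u) ^ m * (2 * v) ^ n := by
            gcongr
        _ = _ := by rw [mul_pow, mul_pow]; ring
    have h5 : 1 / 4 ≤ (2 ^ m * 2 ^ n) * (u ^ m * v ^ n) * ‖k (1 / 2 + (x : ℂ) + h)‖ :=
      l2.trans (mul_le_mul_of_nonneg_right h4 hkp.le)
    refine le_of_mul_le_mul_left ?_ huv
    calc _ ≤ 2 := l1
      _ = 8 * (1 / 4) := by norm_num
      _ ≤ 8 * ((2 ^ m * 2 ^ n) * (u ^ m * v ^ n) * ‖k (1 / 2 + (x : ℂ) + h)‖) := by gcongr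
      _ = _ := by ring
  -- On the imaginary axis numerator and denominator have equal modulus.
  · intro y
    have e : (y * Complex.I : ℂ) = Complex.I * y := mul_comm _ _
    simp only [hf]
    rw [e, norm_div, xiFactor_norm_eq_on_line hχ hp hz hk h0 h1 y]
    exact div_self_le_one _

end

/-! ### Positivity of the real part of the logarithmic derivative. -/

section
open DirichletCharacter

theorem logDeriv_pi_mul {f g : ℂ → ℂ} (x : ℂ) (hf : f x ≠ 0) (hg : g x ≠ 0)
    (hdf : DifferentiableAt ℂ f x) (hdg : DifferentiableAt ℂ g x) :
    logDeriv (f * g) x = logDeriv f x + logDeriv g x :=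
  logDeriv_mul x hf hg hdf hdg

/-- The quotient equals `1` at `h = 0` and has modulus at most `1` for small `h > 0`, so its
derivative `-2 N'/N` at `0` has nonpositive real part. -/
theorem re_logDeriv_nonneg_of_norm_div_le {N : ℂ → ℂ} {s : ℂ} (hN : DifferentiableAt ℂ N s)
    (hN0 : N s ≠ 0) {η : ℝ} (hη : 0 < η)
    (hle : ∀ h : ℝ, 0 < h → h < η → ‖N (s - h) / N (s + h)‖ ≤ 1) : 0 ≤ (logDeriv N s).re := by
  have h1 : HasDerivAt (fun h : ℂ => N (s - h)) (-deriv N s) 0 := by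
    have := HasDerivAt.comp_const_sub s 0 (f := N) (f' := deriv N s) (by simpa using hN.hasDerivAt)
    simpa using this
  have h2 : HasDerivAt (fun h : ℂ => N (s + h)) (deriv N s) 0 := by
    have := HasDerivAt.comp_const_add s 0 (f := N) (f' := deriv N s) (by simpa using hN.hasDerivAt)
    simpa using this
  have h3 : HasDerivAt (fun h : ℂ => N (s - h) / N (s + h)) (-2 * logDeriv N s) ((0 : ℝ) : ℂ) := by
    rw [Complex.ofReal_zero]
    refine (h1.fun_div h2 (by simpa using hN0)).congr_deriv ?_
    simp only [sub_zero, add_zero, logDeriv_apply]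
    field_simp
    ring
  have h4 := h3.real_of_complex.tendsto_slope_zero_right
  have h5 : (-2 * logDeriv N s).re ≤ 0 := by
    refine le_of_tendsto h4 ?_
    filter_upwards [Ioo_mem_nhdsGT hη] with h hh
    have h6 := (Complex.re_le_norm _).trans (hle h hh.1 hh.2)
    simp only [zero_add, Complex.ofReal_zero, sub_zero, add_zero, div_self hN0, Complex.one_re,
      smul_eq_mul]
    exact mul_nonpos_of_nonneg_of_nonpos (inv_nonneg.2 hh.1.le) (by linarith)
  simp at h5
  linarith

variable {q : ℕ} [NeZero q] {χ : DirichletCharacter ℂ q}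

/-- Under the Riemann hypothesis for `L(s, χ)`, zeros contribute at most the archimedean terms plus
the real part of `L'/L`. -/
theorem zeros_le_re_logDeriv (hχ : χ ≠ 1) (hp : χ.IsPrimitive)
    (hz : ∀ s : ℂ, 1 / 2 < s.re → LFunction χ s ≠ 0) {γ₁ γ₂ : ℝ} (hγ : γ₁ ≠ γ₂) {m n : ℕ}
    (hm : (m : ℕ∞) ≤ analyticOrderAt (LFunction χ) (1 / 2 + Complex.I * γ₁))
    (hn : (n : ℕ∞) ≤ analyticOrderAt (LFunction χ) (1 / 2 + Complex.I * γ₂)) {s : ℂ}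
    (hs : 1 / 2 < s.re) :
    m * (1 / (s - (1 / 2 + Complex.I * γ₁))).re + n * (1 / (s - (1 / 2 + Complex.I * γ₂))).re ≤
      Real.log q / 2 + (logDeriv χ.gammaFactor s).re + (logDeriv (LFunction χ) s).re := by
  have hab : (1 / 2 + Complex.I * γ₁ : ℂ) ≠ 1 / 2 + Complex.I * γ₂ := by
    intro h; apply hγ
    have := congrArg Complex.im h
    simpa using this
  obtain ⟨k, hkd, hk⟩ := exists_eq_pow_mul_pow_mul (differentiable_LFunction hχ) hab m n hm hn
  have hs0 : 0 < s.re := by linarith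
  have hLs := hz s hs
  have hks : k s ≠ 0 := by
    intro h; exact hLs (by rw [hk, h, mul_zero])
  have hne : ∀ γ : ℝ, s - (1 / 2 + Complex.I * γ) ≠ 0 := by
    intro γ e
    have := congrArg Complex.re e
    simp at this
    linarith
  -- Positivity is applied to the cofactor only; it accounts for all zeros that were not divided
  -- out.
  have hpos := re_logDeriv_nonneg_of_norm_div_le (differentiableAt_xiFactor χ hkd hs0)
    (xiFactor_ne_zero χ hs0 hks) (η := 1 / 4) (by norm_num)
    (fun h h0 h1 => norm_xiFactor_div_le_one hχ hp hz hkd hk h0 h1 hs.le)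
  have hqd : HasDerivAt (fun s : ℂ => (q : ℂ) ^ (s / 2)) ((q : ℂ) ^ (s / 2) * Complex.log q * (1 / 2)) s :=
    ((hasDerivAt_id s).div_const 2).const_cpow (Or.inl (NeZero.ne _))
  have hq0 : (q : ℂ) ^ (s / 2) ≠ 0 := by simp [Complex.cpow_eq_zero_iff, NeZero.ne q]
  have e1 : logDeriv (xiFactor χ k) s = Real.log q / 2 + logDeriv χ.gammaFactor s + logDeriv k s := by
    have : xiFactor χ k = ((fun s : ℂ => (q : ℂ) ^ (s / 2)) * χ.gammaFactor) * k := rfl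
    rw [this, logDeriv_pi_mul (f := (fun s : ℂ => (q : ℂ) ^ (s / 2)) * χ.gammaFactor) s (mul_ne_zero hq0 (gammaFactor_ne_zero χ hs0)) hks
      (hqd.differentiableAt.mul (differentiableAt_gammaFactor χ hs0)) (hkd s),
      logDeriv_pi_mul (f := fun s : ℂ => (q : ℂ) ^ (s / 2)) s hq0 (gammaFactor_ne_zero χ hs0) hqd.differentiableAt
      (differentiableAt_gammaFactor χ hs0), logDeriv_apply (fun s : ℂ => (q : ℂ) ^ (s / 2)), hqd.deriv,
      mul_assoc, mul_div_cancel_left₀ _ hq0, Complex.natCast_log]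
    ring
  have hpw : ∀ (γ : ℝ) (m : ℕ), logDeriv (fun s : ℂ => (s - (1 / 2 + Complex.I * γ)) ^ m) s =
      m * (1 / (s - (1 / 2 + Complex.I * γ))) := by
    intro γ m
    rw [logDeriv_fun_pow (by fun_prop), logDeriv_apply, deriv_sub_const, deriv_id'']
  have hdp : ∀ (γ : ℝ) (m : ℕ), DifferentiableAt ℂ (fun s : ℂ => (s - (1 / 2 + Complex.I * γ)) ^ m) s :=
    fun γ m => by fun_prop
  have e2 : logDeriv (LFunction χ) s = m * (1 / (s - (1 / 2 + Complex.I * γ₁))) +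
      n * (1 / (s - (1 / 2 + Complex.I * γ₂))) + logDeriv k s := by
    have : LFunction χ = ((fun s : ℂ => (s - (1 / 2 + Complex.I * γ₁)) ^ m) *
      (fun s : ℂ => (s - (1 / 2 + Complex.I * γ₂)) ^ n)) * k := funext hk
    rw [this, logDeriv_pi_mul (f := (fun s : ℂ => (s - (1 / 2 + Complex.I * γ₁)) ^ m) *
        (fun s : ℂ => (s - (1 / 2 + Complex.I * γ₂)) ^ n)) s (mul_ne_zero (pow_ne_zero _ (hne _)) (pow_ne_zero _ (hne _))) hks
      ((hdp _ _).mul (hdp _ _)) (hkd s),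
      logDeriv_pi_mul (f := fun s : ℂ => (s - (1 / 2 + Complex.I * γ₁)) ^ m)
        (g := fun s : ℂ => (s - (1 / 2 + Complex.I * γ₂)) ^ n) s
      (pow_ne_zero _ (hne _)) (pow_ne_zero _ (hne _))
      (hdp _ _) (hdp _ _), hpw, hpw]
  have e3 := congrArg Complex.re e1
  have e4 := congrArg Complex.re e2
  have nr : ∀ (m : ℕ) (z : ℂ), (m * z).re = m * z.re := fun m z => by
    rw [← Complex.ofReal_natCast, Complex.re_ofReal_mul]
  have lr : ((Real.log q : ℂ) / 2).re = Real.log q / 2 := by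
    rw [← Complex.ofReal_ofNat, ← Complex.ofReal_div, Complex.ofReal_re]
  rw [Complex.add_re, Complex.add_re, lr] at e3
  rw [Complex.add_re, Complex.add_re, nr, nr] at e4
  linarith

end

/-! ### An upper bound for the digamma function and the archimedean term. -/

section

theorem norm_cpow_sub_one_le {w : ℂ} (hw : 1 ≤ w.re) {x : ℝ} (h0 : 0 < x) (h1 : x ≤ 1) :
    ‖(x : ℂ) ^ w - 1‖ ≤ ‖w‖ * (1 - x) := by
  have hw0 : w ≠ 0 := by rintro rfl; simp at hw; linarith
  have hd : ∀ t ∈ Set.Icc x 1, HasDerivWithinAt (fun t : ℝ => (t : ℂ) ^ w) (w * (t : ℂ) ^ (w - 1))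
      (Set.Icc x 1) t := fun t ht =>
    (((hasDerivAt_id (t : ℂ)).cpow_const (Complex.ofReal_mem_slitPlane.2
      (h0.trans_le ht.1))).comp_ofReal.congr_deriv (by simp)).hasDerivWithinAt
  have := (convex_Icc x 1).norm_image_sub_le_of_norm_hasDerivWithin_le hd (C := ‖w‖) (fun t ht => ?_)
    (Set.right_mem_Icc.2 h1) (Set.left_mem_Icc.2 h1)
  · simpa [Real.norm_eq_abs, abs_sub_comm x 1, abs_of_nonneg (sub_nonneg.2 h1)] using this
  · have ht0 : 0 < t := h0.trans_le ht.1
    rw [norm_mul, Complex.norm_cpow_eq_rpow_re_of_pos ht0]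
    exact mul_le_of_le_one_right (norm_nonneg _)
      (Real.rpow_le_one ht0.le ht.2 (by simpa using hw))

/-- Geometric mean of the bounds `2` and `‖w‖ (1 - x)`. The factor `(1 - x)^(1/2)` makes the
singularity `(1 - x)^(-1)` integrable. -/
theorem norm_cpow_sub_one_le_sqrt {w : ℂ} (hw : 1 ≤ w.re) {x : ℝ} (h0 : 0 < x) (h1 : x ≤ 1) :
    ‖(x : ℂ) ^ w - 1‖ ≤ Real.sqrt (2 * ‖w‖) * (1 - x) ^ (1 / 2 : ℝ) := by
  rw [← Real.sqrt_eq_rpow, ← Real.sqrt_mul (by positivity)]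
  apply Real.le_sqrt_of_sq_le
  have a1 := norm_cpow_sub_one_le hw h0 h1
  have a2 : ‖(x : ℂ) ^ w - 1‖ ≤ 2 := by
    refine (norm_sub_le _ _).trans ?_
    rw [Complex.norm_cpow_eq_rpow_re_of_pos h0, norm_one]
    linarith [Real.rpow_le_one h0.le h1 (by linarith : 0 ≤ w.re)]
  nlinarith [norm_nonneg ((x : ℂ) ^ w - 1)]

/-- The bound is uniform as `h → 0`, although each beta integral diverges: `(1 - x)^(h - 1) ≤ (1 -
x)^(-1)`, and the difference of the integrands is then at most a multiple of `(1 - x)^(-1/2)`, whose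
integral is `2`. -/
theorem norm_betaIntegral_sub_le {w : ℂ} (hw : 1 ≤ w.re) {h : ℝ} (hh : 0 < h) :
    ‖Complex.betaIntegral (w + 1) h - Complex.betaIntegral 1 h‖ ≤ 2 * Real.sqrt (2 * ‖w‖) := by
  have hint : IntervalIntegrable (fun x : ℝ => (1 - x) ^ (-(1 / 2) : ℝ)) volume 0 1 := by
    have := (intervalIntegral.intervalIntegrable_rpow' (a := 1) (b := 0) (r := -(1 / 2))
      (by norm_num)).comp_sub_left 1
    simpa using this
  have hval : ∫ x in (0 : ℝ)..1, (1 - x) ^ (-(1 / 2) : ℝ) = 2 := by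
    rw [intervalIntegral.integral_comp_sub_left (fun x : ℝ => x ^ (-(1 / 2) : ℝ)),
      integral_rpow (Or.inl (by norm_num))]
    norm_num
  rw [Complex.betaIntegral, Complex.betaIntegral, ← intervalIntegral.integral_sub
    (Complex.betaIntegral_convergent (by simp; linarith) (by simpa))
    (Complex.betaIntegral_convergent (by simp) (by simpa))]
  have : 2 * Real.sqrt (2 * ‖w‖) = ∫ x in (0 : ℝ)..1, Real.sqrt (2 * ‖w‖) * (1 - x) ^ (-(1 / 2) : ℝ) := by
    rw [intervalIntegral.integral_const_mul, hval, mul_comm]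
  rw [this]
  refine intervalIntegral.norm_integral_le_of_norm_le zero_le_one ?_ (hint.const_mul _)
  filter_upwards [compl_mem_ae_iff.2 (measure_singleton (1 : ℝ))] with x hx1 hx
  have hx2 : 0 < 1 - x := sub_pos.2 (lt_of_le_of_ne hx.2 hx1)
  have h1 : (1 : ℂ) - (x : ℂ) = ((1 - x : ℝ) : ℂ) := by simp
  have e : (x : ℂ) ^ (w + 1 - 1) * (1 - (x : ℂ)) ^ ((h : ℂ) - 1) -
      (x : ℂ) ^ ((1 : ℂ) - 1) * (1 - (x : ℂ)) ^ ((h : ℂ) - 1) =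
      ((x : ℂ) ^ w - 1) * ((1 - x : ℝ) : ℂ) ^ ((h : ℂ) - 1) := by
    rw [add_sub_cancel_right, sub_self, Complex.cpow_zero, h1]; ring
  rw [e, norm_mul, Complex.norm_cpow_eq_rpow_re_of_pos hx2]
  have e2 : ((h : ℂ) - 1).re = h - 1 := by simp
  rw [e2]
  calc _ ≤ Real.sqrt (2 * ‖w‖) * (1 - x) ^ (1 / 2 : ℝ) * (1 - x) ^ (-1 : ℝ) := by
        refine mul_le_mul (norm_cpow_sub_one_le_sqrt hw hx.1 hx.2) ?_ (by positivity) (by positivity)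
        exact Real.rpow_le_rpow_of_exponent_ge hx2 (by linarith [hx.1]) (by linarith)
    _ = _ := by
        rw [mul_assoc, ← Real.rpow_add hx2]; norm_num

/-- The difference quotient at `0` of `h ↦ Γ(1 + h) Γ(w + 1) / Γ(w + 1 + h)` is `B(w + 1, h) - B(1,
h)`, and its limit is `ψ(1) - ψ(w + 1)`. -/
theorem norm_digamma_sub_le {w : ℂ} (hw : 1 ≤ w.re) :
    ‖Complex.digamma (w + 1) - Complex.digamma 1‖ ≤ 2 * Real.sqrt (2 * ‖w‖) := by
  have hne : ∀ z : ℂ, 0 < z.re → ∀ m : ℕ, z ≠ -m := by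
    rintro z hz m rfl
    simp at hz
    linarith [m.cast_nonneg (α := ℝ)]
  have hd : ∀ z : ℂ, 0 < z.re → HasDerivAt (fun h : ℂ => Complex.Gamma (z + h)) (deriv Complex.Gamma z) 0 := by
    intro z hz
    have := HasDerivAt.comp_const_add z 0 (f := Complex.Gamma) (f' := deriv Complex.Gamma z)
      (by simpa using (Complex.differentiableAt_Gamma z (hne z hz)).hasDerivAt)
    simpa using this
  have hwre : 0 < (w + 1).re := by simp; linarith
  have hG : Complex.Gamma (w + 1) ≠ 0 := Complex.Gamma_ne_zero_of_re_pos hwre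
  have hE : HasDerivAt (fun h : ℂ => Complex.Gamma (1 + h) * Complex.Gamma (w + 1) / Complex.Gamma (w + 1 + h))
      (Complex.digamma 1 - Complex.digamma (w + 1)) ((0 : ℝ) : ℂ) := by
    rw [Complex.ofReal_zero]
    refine (((hd 1 (by simp)).mul_const (Complex.Gamma (w + 1))).fun_div (hd (w + 1) hwre)
      (by simpa using hG)).congr_deriv ?_
    rw [Complex.digamma_def, logDeriv_apply, logDeriv_apply, Complex.Gamma_one]
    simp only [add_zero, Complex.Gamma_one]
    field_simp
  have hlim := hE.comp_ofReal.tendsto_slope_zero_right.norm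
  rw [norm_sub_rev]
  refine le_of_tendsto hlim ?_
  filter_upwards [self_mem_nhdsWithin] with h hh
  have hh0 : 0 < h := hh
  have hb := norm_betaIntegral_sub_le hw hh0
  rw [Complex.betaIntegral_eq_Gamma_mul_div _ _ hwre (by simpa),
    Complex.betaIntegral_eq_Gamma_mul_div _ _ (by simp) (by simpa), Complex.Gamma_one] at hb
  have hG1 : Complex.Gamma (1 + h) = h * Complex.Gamma h := by
    rw [add_comm]; exact Complex.Gamma_add_one _ (by exact_mod_cast hh0.ne')
  have hG2 : Complex.Gamma h ≠ 0 := Complex.Gamma_ne_zero_of_re_pos (by simpa)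
  have hhC : (h : ℂ) ≠ 0 := by exact_mod_cast hh0.ne'
  simp only [zero_add, Complex.ofReal_zero, add_zero, Complex.Gamma_one, one_mul, div_self hG,
    Complex.real_smul, Complex.ofReal_inv]
  refine le_of_eq_of_le (congrArg norm ?_) hb
  rw [hG1]
  field_simp

/-- Two steps of the recurrence reach `z + 2`, where the previous bound applies. The discarded terms
`-1/z` and `-1/(z + 1)` have nonpositive real part, so the one-sided bound is uniform up to `Re z =
0`. -/
theorem re_digamma_le : ∃ C : ℝ, 0 ≤ C ∧ ∀ z : ℂ, 0 < z.re →
    (Complex.digamma z).re ≤ C * Real.sqrt (1 + ‖z‖) := by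
  refine ⟨‖Complex.digamma 1‖ + 4, by positivity, fun z hz => ?_⟩
  have hne : ∀ z : ℂ, 0 < z.re → ∀ m : ℕ, z ≠ -m := by
    rintro z hz m rfl
    simp at hz
    linarith [m.cast_nonneg (α := ℝ)]
  have hinv : ∀ z : ℂ, 0 < z.re → 0 ≤ (z⁻¹).re := by
    intro z hz
    rw [Complex.inv_re]
    exact div_nonneg hz.le (Complex.normSq_nonneg _)
  have hz1 : 0 < (z + 1).re := by simp; linarith
  have e1 := congrArg Complex.re (Complex.digamma_apply_add_one z (hne z hz))
  have e2 := congrArg Complex.re (Complex.digamma_apply_add_one (z + 1) (hne _ hz1))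
  rw [Complex.add_re] at e1 e2
  have h3 := norm_digamma_sub_le (w := z + 1) (by simp; linarith)
  have h4 : (Complex.digamma (z + 1 + 1)).re ≤ ‖Complex.digamma 1‖ + 2 * Real.sqrt (2 * ‖z + 1‖) := by
    refine (Complex.re_le_norm _).trans ?_
    have := norm_add_le (Complex.digamma (z + 1 + 1) - Complex.digamma 1) (Complex.digamma 1)
    rw [sub_add_cancel] at this
    linarith
  have h5 : Real.sqrt (2 * ‖z + 1‖) ≤ 2 * Real.sqrt (1 + ‖z‖) := by
    have : (2 : ℝ) = Real.sqrt 4 := by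
      rw [show (4 : ℝ) = 2 ^ 2 by norm_num, Real.sqrt_sq (by norm_num)]
    rw [this, ← Real.sqrt_mul (by norm_num), ← this]
    refine Real.sqrt_le_sqrt ?_
    have := norm_add_le z 1
    rw [norm_one] at this
    linarith [norm_nonneg z, norm_nonneg (z + 1)]
  have h6 : 1 ≤ Real.sqrt (1 + ‖z‖) := Real.one_le_sqrt.2 (by linarith [norm_nonneg z])
  have h7 := hinv z hz
  have h8 := hinv (z + 1) hz1
  nlinarith [norm_nonneg (Complex.digamma 1)]

theorem logDeriv_Gammaℝ {s : ℂ} (hs : 0 < s.re) :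
    logDeriv Complex.Gammaℝ s = -(Real.log Real.pi / 2 : ℝ) + Complex.digamma (s / 2) / 2 := by
  have hpi : (Real.pi : ℂ) ≠ 0 := by exact_mod_cast Real.pi_ne_zero
  have hs2 : 0 < (s / 2).re := by simpa using hs
  have h1 : HasDerivAt (fun s : ℂ => (Real.pi : ℂ) ^ (-s / 2))
      ((Real.pi : ℂ) ^ (-s / 2) * Complex.log Real.pi * (-1 / 2)) s :=
    (((hasDerivAt_id s).neg).div_const 2).const_cpow (Or.inl hpi)
  have h2 : HasDerivAt (fun s : ℂ => Complex.Gamma (s / 2)) (deriv Complex.Gamma (s / 2) * (1 / 2)) s := by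
    refine HasDerivAt.comp s (h₂ := Complex.Gamma) (h := fun s => s / 2) ?_ ((hasDerivAt_id s).div_const 2)
    refine (Complex.differentiableAt_Gamma _ ?_).hasDerivAt
    intro m h
    rw [h] at hs2
    simp at hs2
    linarith [m.cast_nonneg (α := ℝ)]
  have hG : Complex.Gamma (s / 2) ≠ 0 := Complex.Gamma_ne_zero_of_re_pos hs2
  have hp0 : (Real.pi : ℂ) ^ (-s / 2) ≠ 0 := by simp [Complex.cpow_eq_zero_iff, Real.pi_ne_zero]
  have h3 : Complex.Gammaℝ = (fun s : ℂ => (Real.pi : ℂ) ^ (-s / 2)) * fun s : ℂ => Complex.Gamma (s / 2) := by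
    ext s; exact Complex.Gammaℝ_def s
  rw [h3, logDeriv_apply, (h1.mul h2).deriv, Complex.digamma_def, logDeriv_apply, Pi.mul_apply]
  rw [← Complex.ofReal_log Real.pi_pos.le]
  push_cast
  field_simp

/-- One constant serves every modulus and character, because only the parity of `χ` enters. -/
theorem re_logDeriv_gammaFactor_le : ∃ C : ℝ, 0 ≤ C ∧ ∀ (q : ℕ) (χ : DirichletCharacter ℂ q) (s : ℂ),
    0 < s.re → (logDeriv χ.gammaFactor s).re ≤ C * Real.sqrt (2 + ‖s‖) := by
  obtain ⟨C, hC, hb⟩ := re_digamma_le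
  -- The slack `t + 1` covers both parities: the odd case evaluates at `s + 1`.
  have key : ∀ s : ℂ, 0 < s.re → ∀ t : ℝ, ‖s‖ ≤ t + 1 →
      (logDeriv Complex.Gammaℝ s).re ≤ C * Real.sqrt (2 + t) := by
    intro s hs t hst
    have h1 := hb (s / 2) (by simpa using hs)
    have h2 : Real.sqrt (1 + ‖s / 2‖) ≤ Real.sqrt (2 + t) := by
      refine Real.sqrt_le_sqrt ?_
      rw [norm_div]
      norm_num
      linarith [norm_nonneg s]
    have h3 : 0 ≤ Real.log Real.pi := Real.log_nonneg (by linarith [Real.pi_gt_three])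
    rw [logDeriv_Gammaℝ hs]
    have e : (-((Real.log Real.pi / 2 : ℝ) : ℂ) + Complex.digamma (s / 2) / 2).re =
        -(Real.log Real.pi / 2) + (Complex.digamma (s / 2)).re / 2 := by
      rw [Complex.add_re, Complex.neg_re, Complex.ofReal_re, Complex.div_ofNat_re]
    rw [e]
    have h4 : C * Real.sqrt (1 + ‖s / 2‖) ≤ C * Real.sqrt (2 + t) := mul_le_mul_of_nonneg_left h2 hC
    have h5 : 0 ≤ C * Real.sqrt (2 + t) := by positivity
    linarith
  refine ⟨C, hC, fun q χ s hs => ?_⟩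
  rcases χ.even_or_odd with he | ho
  · rw [funext he.gammaFactor_def]
    exact key s hs _ (by linarith)
  · rw [funext ho.gammaFactor_def]
    have e : logDeriv (fun s => Complex.Gammaℝ (s + 1)) s = logDeriv Complex.Gammaℝ (s + 1) := by
      rw [logDeriv_apply, logDeriv_apply, deriv_comp_add_const]
    rw [e]
    exact key _ (by simp; linarith) _ ((norm_add_le _ _).trans (by simp))

end

/-! ### The window, its Fourier transform and its self-convolution. -/

section
open FourierTransform

/-- The additive character `x ↦ exp (2 π i x)`. -/
noncomputable def addExp (x : ℝ) : ℂ := Complex.exp ((2 * Real.pi * x : ℝ) * Complex.I)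

theorem norm_addExp (x : ℝ) : ‖addExp x‖ = 1 := Complex.norm_exp_ofReal_mul_I _

theorem addExp_add (x y : ℝ) : addExp (x + y) = addExp x * addExp y := by
  rw [addExp, addExp, addExp, ← Complex.exp_add]; push_cast; ring_nf

theorem addExp_zero : addExp 0 = 1 := by simp [addExp]

theorem continuous_addExp : Continuous addExp := by unfold addExp; fun_prop

theorem integral_addExp (c : ℝ) :
    ∫ v in (-1 : ℝ)..1, addExp (c * v) = (2 * Real.sinc (2 * Real.pi * c) : ℝ) := by
  rcases eq_or_ne c 0 with rfl | hc
  · simp [addExp]; norm_num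
  · have h : ∀ v : ℝ, addExp (c * v) = Complex.exp (((2 * Real.pi * c : ℝ) * Complex.I) * v) := by
      intro v; rw [addExp]; push_cast; ring_nf
    have h0 : (2 * Real.pi * c : ℝ) ≠ 0 := mul_ne_zero (by positivity) hc
    have h1 : ((2 * Real.pi * c : ℝ) : ℂ) ≠ 0 := by exact_mod_cast h0
    simp_rw [h]
    rw [integral_exp_mul_complex (mul_ne_zero h1 Complex.I_ne_zero), Real.sinc_of_ne_zero h0]
    generalize 2 * Real.pi * c = r at h1
    rw [Complex.ofReal_mul, Complex.ofReal_div, Complex.ofReal_sin, Complex.sin]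
    generalize (r : ℂ) = x at h1
    have e1 : x * Complex.I * ((1 : ℝ) : ℂ) = x * Complex.I := by simp
    have e2 : x * Complex.I * ((-1 : ℝ) : ℂ) = -x * Complex.I := by simp
    rw [e1, e2]
    field_simp
    rw [Complex.I_sq]
    push_cast
    ring

/-- The two-frequency window `1_{[-1,1]}(v) (e(tv) + ε e(-tv))`. -/
noncomputable def window (t ε : ℝ) : ℝ → ℂ :=
  (Set.Icc (-1 : ℝ) 1).indicator fun v => addExp (t * v) + ε * addExp (-t * v)

/-- The Fourier transform of `window`. -/
noncomputable def windowHat (t ε x : ℝ) : ℝ :=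
  2 * Real.sinc (2 * Real.pi * (t - x)) + ε * (2 * Real.sinc (2 * Real.pi * (-t - x)))

/-- The self-convolution of `window`. -/
noncomputable def windowConv (t ε u : ℝ) : ℂ := ∫ v, window t ε v * window t ε (u - v)

variable (t ε : ℝ)

theorem continuous_window_formula :
    Continuous fun v : ℝ => addExp (t * v) + ε * addExp (-t * v) := by
  unfold addExp; fun_prop

theorem measurable_window : Measurable (window t ε) :=
  (continuous_window_formula t ε).measurable.indicator measurableSet_Icc

theorem integrable_window : Integrable (window t ε) :=
  (integrable_indicator_iff measurableSet_Icc).2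
    (continuous_window_formula t ε).continuousOn.integrableOn_Icc

theorem integral_window_mul (F : ℝ → ℂ) :
    ∫ v, window t ε v * F v = ∫ v in (-1 : ℝ)..1, (addExp (t * v) + ε * addExp (-t * v)) * F v := by
  rw [intervalIntegral.integral_of_le (by norm_num), ← integral_Icc_eq_integral_Ioc,
    ← integral_indicator measurableSet_Icc]
  congr 1
  ext v
  rw [window, Set.indicator_apply, Set.indicator_apply]
  split_ifs <;> simp

theorem fourier_window (x : ℝ) : 𝓕 (window t ε) x = windowHat t ε x := by
  rw [Real.fourier_real_eq_integral_exp_smul]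
  have h : ∀ v : ℝ, Complex.exp (((-2 * Real.pi * v * x : ℝ) : ℂ) * Complex.I) • window t ε v =
      window t ε v * addExp (-x * v) := by
    intro v
    rw [smul_eq_mul, mul_comm, addExp]
    congr 3
    push_cast; ring
  simp_rw [h]
  rw [integral_window_mul]
  have h2 : ∀ v : ℝ, (addExp (t * v) + ε * addExp (-t * v)) * addExp (-x * v) =
      addExp ((t - x) * v) + ε * addExp ((-t - x) * v) := by
    intro v
    rw [add_mul, mul_assoc, ← addExp_add, ← addExp_add]
    ring_nf
  simp_rw [h2]
  have hi : ∀ c : ℝ, IntervalIntegrable (fun v : ℝ => addExp (c * v)) volume (-1) 1 := fun c =>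
    Continuous.intervalIntegrable (continuous_addExp.comp (by fun_prop)) _ _
  rw [intervalIntegral.integral_add (hi _) ((hi _).const_mul _), intervalIntegral.integral_const_mul,
    integral_addExp, integral_addExp, windowHat]
  push_cast
  ring

variable {t ε}

theorem norm_window_le (hε : |ε| = 1) (v : ℝ) : ‖window t ε v‖ ≤ 2 := by
  refine (norm_indicator_le_norm_self _ _).trans ((norm_add_le _ _).trans ?_)
  rw [norm_mul, norm_addExp, norm_addExp, Complex.norm_real, Real.norm_eq_abs, hε]
  norm_num

theorem continuousAt_window {v : ℝ} (h1 : v ≠ 1) (h2 : v ≠ -1) : ContinuousAt (window t ε) v := by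
  refine (continuous_window_formula t ε).continuousOn.continuousAt_indicator ?_
  rw [frontier_Icc (by norm_num)]
  simp [h1, h2]

theorem continuous_windowConv (hε : |ε| = 1) : Continuous (windowConv t ε) := by
  rw [continuous_iff_continuousAt]
  intro u
  refine continuousAt_of_dominated (bound := fun v => ‖window t ε v‖ * 2) ?_ ?_
    ((integrable_window t ε).norm.mul_const 2) ?_
  · exact .of_forall fun u => ((measurable_window t ε).mul
      ((measurable_window t ε).comp (measurable_const.sub measurable_id))).aestronglyMeasurable
  · refine .of_forall fun u => .of_forall fun v => ?_
    rw [norm_mul]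
    exact mul_le_mul_of_nonneg_left (norm_window_le hε _) (norm_nonneg _)
  · filter_upwards [compl_mem_ae_iff.2 (measure_singleton (u - 1 : ℝ)),
      compl_mem_ae_iff.2 (measure_singleton (u + 1 : ℝ))] with v hv1 hv2
    refine continuousAt_const.mul (ContinuousAt.comp (g := window t ε) ?_ (by fun_prop))
    refine continuousAt_window (fun h => hv1 ?_) (fun h => hv2 ?_)
    · simp only [Set.mem_singleton_iff]; linarith
    · simp only [Set.mem_singleton_iff]; linarith

theorem windowConv_eq_convolution :
    windowConv t ε = convolution (window t ε) (window t ε) (ContinuousLinearMap.mul ℂ ℂ) volume := by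
  ext u
  rw [convolution_def]
  rfl

theorem integrable_windowConv : Integrable (windowConv t ε) := by
  rw [windowConv_eq_convolution]
  exact (integrable_window t ε).integrable_convolution _ (integrable_window t ε)

theorem fourier_windowConv (x : ℝ) : 𝓕 (windowConv t ε) x = ((windowHat t ε x ^ 2 : ℝ) : ℂ) := by
  rw [windowConv_eq_convolution, Real.fourier_mul_convolution_eq (integrable_window t ε)
    (integrable_window t ε), fourier_window]
  push_cast
  ring

/-- The integrand is at most `4` on the overlap of `[-1, 1]` with its translate. The support
truncates the prime sum, and the linear decay at `|u| = 2` later saves a logarithm. -/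
theorem norm_windowConv_le (hε : |ε| = 1) (u : ℝ) : ‖windowConv t ε u‖ ≤ 4 * max (2 - |u|) 0 := by
  set S : Set ℝ := Set.Icc (max (-1) (u - 1)) (min 1 (u + 1))
  have hb : ∀ v, ‖window t ε v * window t ε (u - v)‖ ≤ S.indicator (fun _ => (4 : ℝ)) v := by
    intro v
    by_cases hv : v ∈ S
    · rw [Set.indicator_of_mem hv, norm_mul]
      nlinarith [norm_window_le (t := t) hε v, norm_window_le (t := t) hε (u - v),
        norm_nonneg (window t ε v), norm_nonneg (window t ε (u - v))]
    · rw [Set.indicator_of_notMem hv]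
      have : v ∉ Set.Icc (-1 : ℝ) 1 ∨ u - v ∉ Set.Icc (-1 : ℝ) 1 := by
        by_contra! h
        refine hv ⟨max_le h.1.1 ?_, le_min h.1.2 ?_⟩
        · linarith [h.2.2]
        · linarith [h.2.1]
      rcases this with h | h
      · simp [window, Set.indicator_of_notMem h]
      · simp [window, Set.indicator_of_notMem h]
  have hvol : (volume S).toReal ≤ max (2 - |u|) 0 := by
    rw [Real.volume_Icc, ENNReal.toReal_ofReal']
    refine max_le_max ?_ le_rfl
    rcases abs_cases u with ⟨h, _⟩ | ⟨h, _⟩ <;> rw [h]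
    · linarith [min_le_left 1 (u + 1), le_max_right (-1) (u - 1)]
    · linarith [min_le_right 1 (u + 1), le_max_left (-1) (u - 1)]
  have hSfin : volume S ≠ ⊤ := by simp [S, Real.volume_Icc]
  calc ‖windowConv t ε u‖ ≤ ∫ v, S.indicator (fun _ => (4 : ℝ)) v :=
        norm_integral_le_of_norm_le ((integrable_indicator_iff measurableSet_Icc).2
          (integrableOn_const hSfin)) (.of_forall hb)
    _ = (volume S).toReal * 4 := by
        rw [integral_indicator measurableSet_Icc, setIntegral_const, smul_eq_mul]; rfl
    _ ≤ _ := by linarith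

theorem windowConv_zero (hε : |ε| = 1) :
    windowConv t ε 0 = ((4 * (1 + ε * Real.sinc (4 * Real.pi * t)) : ℝ) : ℂ) := by
  have hε2 : ε * ε = 1 := by rw [← abs_mul_abs_self, hε]; norm_num
  rw [windowConv, integral_window_mul]
  have h : ∀ v ∈ Set.uIcc (-1 : ℝ) 1, (addExp (t * v) + ε * addExp (-t * v)) * window t ε (0 - v) =
      (2 * addExp (0 * v) + ε * addExp ((2 * t) * v)) + ε * addExp ((-(2 * t)) * v) := by
    intro v hv
    rw [Set.uIcc_of_le (by norm_num)] at hv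
    have hv' : 0 - v ∈ Set.Icc (-1 : ℝ) 1 := ⟨by linarith [hv.2], by linarith [hv.1]⟩
    rw [window, Set.indicator_of_mem hv']
    have e1 : addExp (t * (0 - v)) = addExp (-t * v) := by ring_nf
    have e2 : addExp (-t * (0 - v)) = addExp (t * v) := by ring_nf
    have e3 : addExp (2 * t * v) = addExp (t * v) * addExp (t * v) := by rw [← addExp_add]; ring_nf
    have e4 : addExp (-(2 * t) * v) = addExp (-t * v) * addExp (-t * v) := by rw [← addExp_add]; ring_nf
    have e5 : addExp (t * v) * addExp (-t * v) = 1 := by rw [← addExp_add, ← addExp_zero]; ring_nf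
    have e6 : (ε : ℂ) * ε = 1 := by exact_mod_cast hε2
    rw [e1, e2, e3, e4, zero_mul, addExp_zero]
    linear_combination (1 + (ε : ℂ) * ε) * e5 + e6
  rw [intervalIntegral.integral_congr h]
  have hi : ∀ c : ℝ, IntervalIntegrable (fun v : ℝ => addExp (c * v)) volume (-1) 1 := fun c =>
    Continuous.intervalIntegrable (continuous_addExp.comp (by fun_prop)) _ _
  rw [intervalIntegral.integral_add (((hi _).const_mul _).add ((hi _).const_mul _)) ((hi _).const_mul _),
    intervalIntegral.integral_add ((hi _).const_mul _) ((hi _).const_mul _),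
    intervalIntegral.integral_const_mul, intervalIntegral.integral_const_mul,
    intervalIntegral.integral_const_mul, integral_addExp, integral_addExp, integral_addExp]
  have e1 : 2 * Real.pi * (2 * t) = 4 * Real.pi * t := by ring
  have e2 : 2 * Real.pi * -(2 * t) = -(4 * Real.pi * t) := by ring
  rw [e1, e2, Real.sinc_neg, mul_zero, Real.sinc_zero]
  push_cast
  ring

theorem sinc_sq_le (y : ℝ) : Real.sinc (2 * Real.pi * y) ^ 2 ≤ 2 * (1 + y ^ 2)⁻¹ := by
  have h1 : Real.sinc (2 * Real.pi * y) ^ 2 ≤ 1 := by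
    rw [sq_le_one_iff_abs_le_one]; exact Real.abs_sinc_le_one _
  have h2 : Real.sinc (2 * Real.pi * y) ^ 2 * y ^ 2 ≤ 1 := by
    rcases eq_or_ne y 0 with rfl | hy
    · simp
    · rw [Real.sinc_of_ne_zero (mul_ne_zero (by positivity) hy)]
      have h3 := Real.sin_sq_le_one (2 * Real.pi * y)
      have h4 : (Real.sin (2 * Real.pi * y) / (2 * Real.pi * y)) ^ 2 * y ^ 2 =
          Real.sin (2 * Real.pi * y) ^ 2 / (2 * Real.pi) ^ 2 := by
        field_simp
      rw [h4, div_le_one (by positivity)]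
      nlinarith [Real.pi_gt_three]
  rw [← div_eq_mul_inv, le_div_iff₀ (by positivity)]
  linarith

/-- Quadratic decay of `sinc²`, recentred from `±t` to `0` at the cost of a factor `2 (1 + t²)`. It
gives the integrability needed for Fourier inversion. -/
theorem windowHat_sq_le (hε : |ε| = 1) (x : ℝ) :
    windowHat t ε x ^ 2 ≤ 64 * (1 + t ^ 2) * (1 + x ^ 2)⁻¹ := by
  have hε2 : ε * ε = 1 := by rw [← abs_mul_abs_self, hε]; norm_num
  have key : ∀ s : ℝ, s ^ 2 = t ^ 2 → (1 + (s - x) ^ 2)⁻¹ ≤ 2 * (1 + t ^ 2) * (1 + x ^ 2)⁻¹ := by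
    intro s hs
    rw [← div_eq_mul_inv, inv_eq_one_div, div_le_div_iff₀ (by positivity) (by positivity), ← hs]
    nlinarith [sq_nonneg (s * (s - x)), sq_nonneg (2 * s - x), sq_nonneg (s - x)]
  have h1 := (sinc_sq_le (t - x)).trans (mul_le_mul_of_nonneg_left (key t rfl) zero_le_two)
  have h2 := (sinc_sq_le (-t - x)).trans (mul_le_mul_of_nonneg_left (key (-t) (by ring)) zero_le_two)
  rw [windowHat]
  set A := Real.sinc (2 * Real.pi * (t - x))
  set B := Real.sinc (2 * Real.pi * (-t - x))
  have h3 : (2 * A + ε * (2 * B)) ^ 2 ≤ 8 * A ^ 2 + 8 * B ^ 2 := by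
    have : (2 * A + ε * (2 * B)) ^ 2 = 8 * A ^ 2 + 8 * (ε * ε) * B ^ 2 - (2 * A - ε * (2 * B)) ^ 2 := by
      ring
    rw [this, hε2]
    nlinarith [sq_nonneg (2 * A - ε * (2 * B))]
  nlinarith

theorem continuous_windowHat : Continuous (windowHat t ε) := by
  unfold windowHat
  have := Real.continuous_sinc
  fun_prop

theorem integrable_windowHat_sq (hε : |ε| = 1) : Integrable fun x => windowHat t ε x ^ 2 := by
  refine (integrable_inv_one_add_sq.const_mul (64 * (1 + t ^ 2))).mono'
    (continuous_windowHat.pow 2).aestronglyMeasurable (.of_forall fun x => ?_)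
  rw [Real.norm_eq_abs, abs_of_nonneg (sq_nonneg _)]
  exact windowHat_sq_le hε x

theorem integral_windowHat_sq_mul (hε : |ε| = 1) (u : ℝ) :
    ∫ x : ℝ, ((windowHat t ε x ^ 2 : ℝ) : ℂ) * addExp (u * x) = windowConv t ε u := by
  have hF : 𝓕 (windowConv t ε) = fun x => ((windowHat t ε x ^ 2 : ℝ) : ℂ) := funext fourier_windowConv
  have h := (continuous_windowConv (t := t) hε).fourierInv_fourier_eq integrable_windowConv
    (by rw [hF]; exact (integrable_windowHat_sq hε).ofReal)
  rw [← congrFun h u, Real.fourierInv_eq', hF]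
  congr 1
  ext x
  rw [smul_eq_mul, mul_comm, addExp]
  congr 4

/-- With `windowConv_zero`, the square of this value is `1 + ε sinc(4πt)` times `windowConv t ε 0`;
that ratio produces the constant of the theorem. -/
theorem windowHat_apply_self (t ε : ℝ) :
    windowHat t ε t = 2 * (1 + ε * Real.sinc (4 * Real.pi * t)) := by
  rw [windowHat, sub_self, mul_zero, Real.sinc_zero]
  have : 2 * Real.pi * (-t - t) = -(4 * Real.pi * t) := by ring
  rw [this, Real.sinc_neg]; ring

theorem windowHat_neg_apply_sq (hε : |ε| = 1) :
    windowHat t ε (-t) ^ 2 = (2 * (1 + ε * Real.sinc (4 * Real.pi * t))) ^ 2 := by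
  have hε2 : ε * ε = 1 := by rw [← abs_mul_abs_self, hε]; norm_num
  rw [windowHat]
  have h1 : 2 * Real.pi * (t - -t) = 4 * Real.pi * t := by ring
  have h2 : -t - -t = 0 := by ring
  rw [h1, h2, mul_zero, Real.sinc_zero]
  linear_combination (-4 * Real.sinc (4 * Real.pi * t) ^ 2 + 4) * hε2

end

/-! ### Holomorphic dependence of vertical integrals on the line. -/

section

theorem integrable_rpow_neg_three_halves :
    Integrable fun y : ℝ => (1 + |y|) ^ (-(3 / 2) : ℝ) := by
  have := integrable_one_add_norm (E := ℝ) (μ := volume) (r := 3 / 2) (by norm_num)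
  simpa using this

/-- Integrals of a holomorphic function of moderate growth along vertical lines, against a rapidly
decreasing weight, depend holomorphically on the line. -/
theorem differentiableAt_vertical_integral {F : ℝ → ℝ} (hFc : Continuous F) {A : ℝ}
    (hFA : ∀ y, |F y| ≤ A * (1 + |y|) ^ (-2 : ℝ)) {G : ℂ → ℂ}
    (hG : DifferentiableOn ℂ G {s | 1 / 2 < s.re})
    (hGb : ∀ h : ℝ, 0 < h → h < 1 → ∃ K : ℝ, 0 < K ∧ ∀ s : ℂ, 1 / 2 + h ≤ s.re →
      ‖G s‖ ≤ K * (1 + ‖s‖) ^ (1 / 2 : ℝ)) {w₀ : ℂ} (hw₀ : 0 < w₀.re) :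
    Integrable (fun y : ℝ => (F y : ℂ) * G (1 / 2 + w₀ + Complex.I * y)) ∧
    DifferentiableAt ℂ (fun w : ℂ => ∫ y : ℝ, (F y : ℂ) * G (1 / 2 + w + Complex.I * y)) w₀ := by
  have hA : 0 ≤ A := by
    have := (abs_nonneg _).trans (hFA 0)
    simpa using this
  -- For `w` within `2 * h` of `w₀`, circles of radius `h` about the points of the shifted line
  -- still lie in `Re s ≥ 1/2 + h`, so Cauchy's estimate controls `deriv G`.
  set h : ℝ := min (w₀.re / 4) (1 / 2) with hh
  have h0 : 0 < h := lt_min (by linarith) (by norm_num)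
  have h1 : h < 1 := (min_le_right _ _).trans_lt (by norm_num)
  have h4 : 4 * h ≤ w₀.re := by linarith [min_le_left (w₀.re / 4) (1 / 2)]
  obtain ⟨K, hK, hb⟩ := hGb h h0 h1
  have ho : IsOpen {s : ℂ | 1 / 2 < s.re} := isOpen_lt continuous_const Complex.continuous_re
  set B : ℝ := K * (4 + ‖w₀‖) ^ (1 / 2 : ℝ) with hB
  have hBp : 0 < B := by positivity
  have hre : ∀ w ∈ Metric.ball w₀ (2 * h), ∀ y : ℝ, 1 / 2 + 2 * h ≤ (1 / 2 + w + Complex.I * y).re := by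
    intro w hw y
    rw [Metric.mem_ball, dist_eq_norm] at hw
    have h5 := Complex.abs_re_le_norm (w - w₀)
    rw [Complex.sub_re] at h5
    have h6 := neg_abs_le (w.re - w₀.re)
    simp
    linarith
  have hnorm : ∀ w ∈ Metric.ball w₀ (2 * h), ∀ (y : ℝ) (u : ℂ), ‖u‖ ≤ h →
      ‖G (1 / 2 + w + Complex.I * y + u)‖ ≤ B * (1 + |y|) ^ (1 / 2 : ℝ) := by
    intro w hw y u hu
    have h5 := hre w hw y
    have h6 := neg_abs_le u.re
    have h7 := Complex.abs_re_le_norm u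
    refine (hb _ (by rw [Complex.add_re]; linarith)).trans ?_
    rw [hB, mul_assoc, ← Real.mul_rpow (by positivity) (by positivity)]
    refine mul_le_mul_of_nonneg_left (Real.rpow_le_rpow (by positivity) ?_ (by norm_num)) hK.le
    rw [Metric.mem_ball, dist_eq_norm] at hw
    have n1 : ‖w‖ ≤ ‖w₀‖ + 2 * h := by
      have := norm_add_le (w - w₀) w₀
      rw [sub_add_cancel] at this; linarith
    have n2 : ‖Complex.I * (y : ℂ)‖ = |y| := by simp
    have n3 : ‖(1 / 2 + w + Complex.I * y + u : ℂ)‖ ≤ 1 / 2 + ‖w‖ + |y| + ‖u‖ := by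
      refine (norm_add_le _ _).trans (add_le_add_left ((norm_add_le _ _).trans ?_) _)
      rw [n2]
      exact add_le_add_left ((norm_add_le _ _).trans (by simp)) _
    have h2 : h ≤ 1 / 2 := min_le_right _ _
    nlinarith [abs_nonneg y, norm_nonneg w₀, mul_nonneg (abs_nonneg y) (norm_nonneg w₀)]
  have hdom : ∀ (y : ℝ) (z : ℂ) (D : ℝ), 0 ≤ D → ‖z‖ ≤ D * (1 + |y|) ^ (1 / 2 : ℝ) →
      ‖(F y : ℂ) * z‖ ≤ A * D * (1 + |y|) ^ (-(3 / 2) : ℝ) := by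
    intro y z D hD hz
    rw [norm_mul, Complex.norm_real, Real.norm_eq_abs]
    calc _ ≤ (A * (1 + |y|) ^ (-2 : ℝ)) * (D * (1 + |y|) ^ (1 / 2 : ℝ)) :=
          mul_le_mul (hFA y) hz (norm_nonneg _) (by positivity)
      _ = A * D * ((1 + |y|) ^ (-2 : ℝ) * (1 + |y|) ^ (1 / 2 : ℝ)) := by ring
      _ = _ := by rw [← Real.rpow_add (by positivity)]; norm_num
  have hcont : ∀ w ∈ Metric.ball w₀ (2 * h), ∀ G' : ℂ → ℂ, ContinuousOn G' {s | 1 / 2 < s.re} →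
      Continuous fun y : ℝ => (F y : ℂ) * G' (1 / 2 + w + Complex.I * y) := by
    intro w hw G' hG'
    refine (Complex.continuous_ofReal.comp hFc).mul
      (hG'.comp_continuous (by fun_prop) fun y => ?_)
    have h5 := hre w hw y
    have h6 : 1 / 2 < (1 / 2 + w + Complex.I * y).re := by linarith
    exact h6
  have hint : Integrable (fun y : ℝ => (F y : ℂ) * G (1 / 2 + w₀ + Complex.I * y)) := by
    refine (integrable_rpow_neg_three_halves.const_mul (A * B)).mono'
      (hcont w₀ (Metric.mem_ball_self (by linarith)) G hG.continuousOn).aestronglyMeasurable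
      (.of_forall fun y => hdom y _ B hBp.le ?_)
    simpa using hnorm w₀ (Metric.mem_ball_self (by linarith)) y 0 (by simpa using h0.le)
  refine ⟨hint, (hasDerivAt_integral_of_dominated_loc_of_deriv_le
    (F := fun (w : ℂ) (y : ℝ) => (F y : ℂ) * G (1 / 2 + w + Complex.I * y))
    (F' := fun (w : ℂ) (y : ℝ) => (F y : ℂ) * deriv G (1 / 2 + w + Complex.I * y))
    (bound := fun y => A * (B / h) * (1 + |y|) ^ (-(3 / 2) : ℝ)) (s := Metric.ball w₀ (2 * h))
    (Metric.ball_mem_nhds w₀ (by linarith)) ?_ hint ?_ ?_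
    (integrable_rpow_neg_three_halves.const_mul _) ?_).2.differentiableAt⟩
  · filter_upwards [Metric.ball_mem_nhds w₀ (show 0 < 2 * h by linarith)] with w hw
    exact (hcont w hw G hG.continuousOn).aestronglyMeasurable
  · exact (hcont w₀ (Metric.mem_ball_self (by linarith)) (deriv G)
      (hG.deriv ho).continuousOn).aestronglyMeasurable
  · refine .of_forall fun y w hw => hdom y _ (B / h) (by positivity) ?_
    have := Complex.norm_deriv_le_of_forall_mem_sphere_norm_le (f := G)
      (c := 1 / 2 + w + Complex.I * y) (R := h) (C := B * (1 + |y|) ^ (1 / 2 : ℝ)) h0 ?_ ?_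
    · refine this.trans (le_of_eq (by ring))
    · refine (hG.mono fun s hs => ?_).diffContOnCl
      have hs2 := Metric.closure_ball_subset_closedBall hs
      rw [Metric.mem_closedBall, dist_eq_norm] at hs2
      have h5 := hre w hw y
      have h6 := Complex.abs_re_le_norm (s - (1 / 2 + w + Complex.I * y))
      have h7 := neg_abs_le (s - (1 / 2 + w + Complex.I * y)).re
      rw [Complex.sub_re] at h6 h7
      have h8 : 1 / 2 < s.re := by linarith
      exact h8
    · intro s hs
      have := hnorm w hw y (s - (1 / 2 + w + Complex.I * y)) (by
        rw [mem_sphere_iff_norm] at hs; exact hs.le)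
      simpa using this
  · refine .of_forall fun y w hw => HasDerivAt.const_mul _ ?_
    have hmem : (1 / 2 + w + Complex.I * y) ∈ {s : ℂ | 1 / 2 < s.re} := by
      have h5 := hre w hw y
      have h6 : 1 / 2 < (1 / 2 + w + Complex.I * y).re := by linarith
      exact h6
    have h5 := (hG.differentiableAt (ho.mem_nhds hmem)).hasDerivAt
    have h6 : (1 / 2 + w + Complex.I * y) = w + (1 / 2 + Complex.I * y) := by ring
    rw [h6] at h5
    have h7 := h5.comp_add_const w (1 / 2 + Complex.I * y)
    rw [h6]
    exact h7.congr_of_eventuallyEq (.of_forall fun w => by ring_nf)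

end

/-! ### The test function rescaled to height `1 / log q`. -/

section
open DirichletCharacter

/-- The test function `|windowHat|²` rescaled to zeros at height `2πx / H`. -/
noncomputable def dilatedTest (t ε H y : ℝ) : ℝ := windowHat t ε (y * H / (2 * Real.pi)) ^ 2

variable {t ε H : ℝ}

theorem continuous_dilatedTest : Continuous (dilatedTest t ε H) := by
  unfold dilatedTest
  exact (continuous_windowHat.comp (by fun_prop)).pow 2

theorem dilatedTest_nonneg (y : ℝ) : 0 ≤ dilatedTest t ε H y := sq_nonneg _

theorem dilatedTest_le (hε : |ε| = 1) (hH : 0 < H) :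
    ∃ A : ℝ, ∀ y, |dilatedTest t ε H y| ≤ A * (1 + |y|) ^ (-2 : ℝ) := by
  set c : ℝ := H / (2 * Real.pi) with hc
  have hcp : 0 < c := by positivity
  refine ⟨64 * (1 + t ^ 2) * (2 * (1 + (c ^ 2)⁻¹)), fun y => ?_⟩
  rw [abs_of_nonneg (dilatedTest_nonneg y), dilatedTest]
  have e : y * H / (2 * Real.pi) = c * y := by rw [hc]; ring
  rw [e]
  refine (windowHat_sq_le hε _).trans ?_
  rw [mul_assoc (64 * (1 + t ^ 2))]
  refine mul_le_mul_of_nonneg_left ?_ (by positivity)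
  rw [Real.rpow_neg (by positivity), ← div_eq_mul_inv, inv_eq_one_div,
    div_le_div_iff₀ (by positivity) (by positivity)]
  have h1 : (1 + |y|) ^ (2 : ℝ) = (1 + |y|) ^ 2 := by norm_cast
  rw [h1]
  have h2 : 2 * (1 + (c ^ 2)⁻¹) * (1 + (c * y) ^ 2) =
      2 * (1 + y ^ 2) + 2 * ((c ^ 2)⁻¹ + (c * y) ^ 2) := by
    field_simp
    ring
  rw [h2]
  have h3 : 0 ≤ (c ^ 2)⁻¹ := by positivity
  nlinarith [sq_nonneg (c * y), sq_abs y, sq_nonneg (|y| - 1)]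

theorem integrable_dilatedTest (hε : |ε| = 1) (hH : 0 < H) : Integrable (dilatedTest t ε H) := by
  have h := (integrable_windowHat_sq (t := t) hε).comp_mul_right'
    (g := fun x => windowHat t ε x ^ 2) (R := H / (2 * Real.pi)) (by positivity)
  refine h.congr (.of_forall fun y => ?_)
  simp only [dilatedTest]
  ring_nf

theorem integral_dilatedTest_mul (hε : |ε| = 1) (hH : 0 < H) (v : ℝ) :
    ∫ y : ℝ, (dilatedTest t ε H y : ℂ) * Complex.exp ((v * y : ℝ) * Complex.I) =
      ((2 * Real.pi / H : ℝ) : ℂ) * windowConv t ε (v / H) := by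
  rw [← integral_windowHat_sq_mul hε]
  have hc : 0 < H / (2 * Real.pi) := by positivity
  have h := Measure.integral_comp_mul_right (fun x : ℝ =>
    ((windowHat t ε x ^ 2 : ℝ) : ℂ) * addExp (v / H * x)) (H / (2 * Real.pi))
  have e : |(H / (2 * Real.pi))⁻¹| = 2 * Real.pi / H := by
    rw [abs_of_pos (by positivity), inv_div]
  rw [e, Complex.real_smul] at h
  rw [← h]
  congr 1
  ext y
  have e1 : 2 * Real.pi * (v / H * (y * (H / (2 * Real.pi)))) = v * y := by field_simp
  rw [dilatedTest, addExp, mul_div_assoc, e1]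

theorem integral_dilatedTest (hε : |ε| = 1) (hH : 0 < H) :
    ∫ y : ℝ, dilatedTest t ε H y =
      2 * Real.pi / H * (4 * (1 + ε * Real.sinc (4 * Real.pi * t))) := by
  have h := integral_dilatedTest_mul (t := t) hε hH 0
  rw [zero_div, windowConv_zero hε, ← Complex.ofReal_mul] at h
  rw [← Complex.ofReal_inj, ← h, ← integral_complex_ofReal]
  simp

end

/-! ### The integral of `L'/L` as a finite sum over prime powers. -/

section
open DirichletCharacter

/-- The sum over prime powers in the explicit formula, shifted by `w` from the critical line. -/
noncomputable def primeSum {q : ℕ} (χ : DirichletCharacter ℂ q) (t ε : ℝ) (w : ℂ) : ℂ :=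
  ∑ n ∈ Finset.range (q ^ 2), LSeries.term (fun n => χ n * ArithmeticFunction.vonMangoldt n) (1 / 2 + w) n *
    (((2 * Real.pi / Real.log q : ℝ) : ℂ) * windowConv t ε (-Real.log n / Real.log q))

theorem differentiable_primeSum {q : ℕ} (χ : DirichletCharacter ℂ q) (t ε : ℝ) :
    Differentiable ℂ (primeSum χ t ε) := by
  unfold primeSum
  refine Differentiable.fun_sum fun n _ => Differentiable.mul_const ?_ _
  rcases eq_or_ne n 0 with rfl | hn
  · simp
  · simp_rw [LSeries.term_of_ne_zero hn]
    intro w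
    refine DifferentiableAt.div (by fun_prop) (DifferentiableAt.const_cpow (by fun_prop) (Or.inl ?_)) ?_
    · exact_mod_cast hn
    · simp [Complex.cpow_eq_zero_iff, hn]

variable {q : ℕ} [NeZero q] {χ : DirichletCharacter ℂ q} {t ε : ℝ}

theorem logDeriv_LFunction_eq (χ : DirichletCharacter ℂ q) {s : ℂ} (hs : 1 < s.re) :
    logDeriv (LFunction χ) s = -LSeries (fun n => χ n * ArithmeticFunction.vonMangoldt n) s := by
  have h := LSeries_twist_vonMangoldt_eq χ hs
  rw [logDeriv_apply, deriv_LFunction_eq_deriv_LSeries χ hs, LFunction_eq_LSeries χ hs]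
  have e : LSeries (fun n => χ n * ArithmeticFunction.vonMangoldt n) s =
      LSeries ((fun n : ℕ => χ n) * fun n : ℕ => (ArithmeticFunction.vonMangoldt n : ℂ)) s := rfl
  rw [e, h]
  ring

theorem windowConv_log_eq_zero {q : ℕ} (hq : 1 < q) (hε : |ε| = 1) {n : ℕ} (hn : q ^ 2 ≤ n) :
    windowConv t ε (-Real.log n / Real.log q) = 0 := by
  have hq1 : (1 : ℝ) < q := by exact_mod_cast hq
  have hlog : 0 < Real.log q := Real.log_pos hq1
  have h1 : 2 * Real.log q ≤ Real.log n := by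
    have : Real.log ((q : ℝ) ^ 2) ≤ Real.log n :=
      Real.log_le_log (by positivity) (by exact_mod_cast hn)
    rwa [Real.log_pow] at this
  have h2 : 2 ≤ |-Real.log n / Real.log q| := by
    rw [neg_div, abs_neg]
    refine le_trans ?_ (le_abs_self _)
    rwa [le_div_iff₀ hlog]
  have h3 := norm_windowConv_le (t := t) hε (-Real.log n / Real.log q)
  rw [max_eq_right (by linarith), mul_zero] at h3
  exact norm_le_zero_iff.1 h3

theorem term_vertical (f : ℕ → ℂ) (s : ℂ) (y : ℝ) (n : ℕ) :
    LSeries.term f (s + Complex.I * y) n =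
      LSeries.term f s n * Complex.exp ((-Real.log n * y : ℝ) * Complex.I) := by
  rcases eq_or_ne n 0 with rfl | hn
  · simp
  · have hn' : (n : ℂ) ≠ 0 := by exact_mod_cast hn
    rw [LSeries.term_of_ne_zero hn, LSeries.term_of_ne_zero hn, Complex.cpow_add _ _ hn',
      Complex.cpow_def_of_ne_zero hn' (Complex.I * y), ← div_div, div_eq_mul_inv (_ / _),
      ← Complex.exp_neg, Complex.natCast_log.symm]
    congr 2
    push_cast
    ring

/-- Here the Dirichlet series of `L'/L` converges absolutely and is integrated term by term; the
terms with `n ≥ q ^ 2` vanish by the support of `windowConv`. -/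
theorem vertical_integral_of_re_gt (hq : 1 < q) (hε : |ε| = 1) {w : ℂ} (hw : 1 / 2 < w.re) :
    ∫ y : ℝ, (dilatedTest t ε (Real.log q) y : ℂ) *
      logDeriv (LFunction χ) (1 / 2 + w + Complex.I * y) = -primeSum χ t ε w := by
  have hlog : 0 < Real.log q := Real.log_pos (by exact_mod_cast hq)
  set f : ℕ → ℂ := fun n => χ n * ArithmeticFunction.vonMangoldt n with hf
  have hre : 1 < (1 / 2 + w).re := by simp; linarith
  have hre' : ∀ y : ℝ, 1 < (1 / 2 + w + Complex.I * y).re := fun y => by simp; linarith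
  have hsum : LSeriesSummable f (1 / 2 + w) := LSeriesSummable_twist_vonMangoldt χ hre
  have hterm : ∀ (n : ℕ) (y : ℝ), (dilatedTest t ε (Real.log q) y : ℂ) *
      LSeries.term f (1 / 2 + w + Complex.I * y) n = LSeries.term f (1 / 2 + w) n *
        ((dilatedTest t ε (Real.log q) y : ℂ) * Complex.exp ((-Real.log n * y : ℝ) * Complex.I)) := by
    intro n y; rw [term_vertical]; ring
  have hI : ∀ n : ℕ, Integrable fun y : ℝ =>
      (dilatedTest t ε (Real.log q) y : ℂ) * Complex.exp ((-Real.log n * y : ℝ) * Complex.I) := by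
    intro n
    refine (integrable_dilatedTest hε hlog).ofReal.mul_bdd (c := 1) ?_ (.of_forall fun y => ?_)
    · exact Continuous.aestronglyMeasurable (by fun_prop)
    · rw [Complex.norm_exp_ofReal_mul_I]
  have hmain := hasSum_integral_of_summable_integral_norm
    (F := fun (n : ℕ) (y : ℝ) => (dilatedTest t ε (Real.log q) y : ℂ) *
      LSeries.term f (1 / 2 + w + Complex.I * y) n) (μ := volume) ?_ ?_
  · have hsumeq : ∀ n : ℕ, ∫ y : ℝ, (dilatedTest t ε (Real.log q) y : ℂ) *
        LSeries.term f (1 / 2 + w + Complex.I * y) n = LSeries.term f (1 / 2 + w) n *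
          (((2 * Real.pi / Real.log q : ℝ) : ℂ) * windowConv t ε (-Real.log n / Real.log q)) := by
      intro n
      simp_rw [hterm]
      rw [integral_const_mul, integral_dilatedTest_mul hε hlog]
    simp_rw [hsumeq] at hmain
    have hfin : HasSum (fun n : ℕ => LSeries.term f (1 / 2 + w) n *
        (((2 * Real.pi / Real.log q : ℝ) : ℂ) * windowConv t ε (-Real.log n / Real.log q)))
        (primeSum χ t ε w) := hasSum_sum_of_ne_finset_zero fun n hn => by
      rw [windowConv_log_eq_zero hq hε (by simpa using hn), mul_zero, mul_zero]
    rw [ ← hmain.unique hfin, ← integral_neg]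
    congr 1
    ext y
    rw [tsum_mul_left, logDeriv_LFunction_eq χ (hre' y), LSeries]
    ring
  · intro n
    simp_rw [hterm]
    exact (hI n).const_mul _
  · simp_rw [hterm, norm_mul, Complex.norm_exp_ofReal_mul_I, mul_one, integral_const_mul]
    exact hsum.norm.mul_right _

/-- The explicit formula for `L'/L` on any vertical line to the right of the critical line. -/
theorem vertical_integral_eq (hq : 1 < q) (hχ : χ ≠ 1)
    (hz : ∀ s : ℂ, 1 / 2 < s.re → LFunction χ s ≠ 0) (hε : |ε| = 1) {w : ℂ} (hw : 0 < w.re) :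
    Integrable (fun y : ℝ => (dilatedTest t ε (Real.log q) y : ℂ) *
      logDeriv (LFunction χ) (1 / 2 + w + Complex.I * y)) ∧
    ∫ y : ℝ, (dilatedTest t ε (Real.log q) y : ℂ) *
      logDeriv (LFunction χ) (1 / 2 + w + Complex.I * y) = -primeSum χ t ε w := by
  have hlog : 0 < Real.log q := Real.log_pos (by exact_mod_cast hq)
  have ho : IsOpen {s : ℂ | 1 / 2 < s.re} := isOpen_lt continuous_const Complex.continuous_re
  have ho' : IsOpen {s : ℂ | 0 < s.re} := isOpen_lt continuous_const Complex.continuous_re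
  have hG : DifferentiableOn ℂ (logDeriv (LFunction χ)) {s | 1 / 2 < s.re} :=
    ((differentiable_LFunction hχ).differentiableOn.deriv ho).div
      (differentiable_LFunction hχ).differentiableOn fun s hs => hz s hs
  obtain ⟨A, hA⟩ := dilatedTest_le (t := t) hε hlog
  have hb : ∀ h : ℝ, 0 < h → h < 1 → ∃ K : ℝ, 0 < K ∧ ∀ s : ℂ, 1 / 2 + h ≤ s.re →
      ‖logDeriv (LFunction χ) s‖ ≤ K * (1 + ‖s‖) ^ (1 / 2 : ℝ) := by
    intro h h0 h1
    obtain ⟨K, hK, hb⟩ := LFunction_bounds_right χ hχ hz h0 h1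
    exact ⟨K, hK, fun s hs => (hb s hs).2⟩
  have key := fun (w : ℂ) (hw : 0 < w.re) =>
    differentiableAt_vertical_integral continuous_dilatedTest hA hG hb hw
  refine ⟨(key w hw).1, ?_⟩
  have h1 : AnalyticOnNhd ℂ (fun w : ℂ => ∫ y : ℝ, (dilatedTest t ε (Real.log q) y : ℂ) *
      logDeriv (LFunction χ) (1 / 2 + w + Complex.I * y)) {s : ℂ | 0 < s.re} :=
    DifferentiableOn.analyticOnNhd (fun w hw => (key w hw).2.differentiableWithinAt) ho'
  have h2 : AnalyticOnNhd ℂ (fun w => -primeSum χ t ε w) {s : ℂ | 0 < s.re} :=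
    (differentiable_primeSum χ t ε).neg.differentiableOn.analyticOnNhd ho'
  -- Both sides are holomorphic in the shift `w`, so the identity theorem takes the place of moving
  -- a contour.
  refine h1.eqOn_of_preconnected_of_eventuallyEq h2
    (convex_halfSpace_re_gt 0).isPreconnected (z₀ := 1) (by simp) ?_ hw
  filter_upwards [ho.mem_nhds (show (1 / 2 : ℝ) < (1 : ℂ).re by norm_num)] with z hz
  exact vertical_integral_of_re_gt hq hε hz

end

/-! ### The Poisson kernel. -/

section

/-- The Poisson kernel is an approximate identity. -/
theorem tendsto_poisson_integral {F : ℝ → ℝ} (hF : Continuous F) {B : ℝ} (hB : ∀ y, |F y| ≤ B) (γ : ℝ) :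
    Tendsto (fun δ : ℝ => ∫ y, F y * (δ / (δ ^ 2 + (y - γ) ^ 2))) (𝓝[>] 0) (𝓝 (Real.pi * F γ)) := by
  have h1 : ∀ δ : ℝ, 0 < δ → ∫ y, F y * (δ / (δ ^ 2 + (y - γ) ^ 2)) =
      ∫ v, F (γ + v * δ) * (1 + v ^ 2)⁻¹ := by
    intro δ hδ
    have e1 := integral_add_left_eq_self (μ := (volume : Measure ℝ))
      (fun y => F y * (δ / (δ ^ 2 + (y - γ) ^ 2))) γ
    have e2 := Measure.integral_comp_mul_right (fun x : ℝ => F (γ + x) * (δ / (δ ^ 2 + (γ + x - γ) ^ 2))) δ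
    rw [e1, abs_of_pos (inv_pos.2 hδ), smul_eq_mul] at e2
    rw [← mul_inv_cancel_left₀ hδ.ne' (∫ y, F y * (δ / (δ ^ 2 + (y - γ) ^ 2))), ← e2,
      ← integral_const_mul]
    congr 1
    ext v
    field_simp
    ring_nf
  have h2 : Tendsto (fun δ : ℝ => ∫ v, F (γ + v * δ) * (1 + v ^ 2)⁻¹) (𝓝[>] 0)
      (𝓝 (∫ v, F γ * (1 + v ^ 2)⁻¹)) := by
    refine tendsto_integral_filter_of_dominated_convergence (fun v => B * (1 + v ^ 2)⁻¹) ?_ ?_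
      (integrable_inv_one_add_sq.const_mul B) ?_
    · refine .of_forall fun δ => Continuous.aestronglyMeasurable ?_
      refine (hF.comp (by fun_prop)).mul (Continuous.inv₀ (by fun_prop) fun v => by positivity)
    · refine .of_forall fun δ => .of_forall fun v => ?_
      rw [norm_mul, Real.norm_eq_abs, Real.norm_eq_abs, abs_of_pos (show 0 < (1 + v ^ 2)⁻¹ by positivity)]
      exact mul_le_mul_of_nonneg_right (hB _) (by positivity)
    · refine .of_forall fun v => Tendsto.mul_const _ ?_
      have : Tendsto (fun δ : ℝ => F (γ + v * δ)) (𝓝 0) (𝓝 (F (γ + v * 0))) :=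
        (hF.comp (show Continuous fun δ : ℝ => γ + v * δ by fun_prop)).tendsto 0
      simp only [mul_zero, add_zero] at this
      exact this.mono_left nhdsWithin_le_nhds
  rw [integral_const_mul, integral_univ_inv_one_add_sq, mul_comm] at h2
  refine h2.congr' ?_
  filter_upwards [self_mem_nhdsWithin] with δ hδ
  exact (h1 δ hδ).symm

end

/-! ### The explicit-formula inequality for two zeros. -/

section
open DirichletCharacter

variable {q : ℕ} [NeZero q] {χ : DirichletCharacter ℂ q} {t ε : ℝ}

theorem integrable_dilatedTest_mul_sqrt {H : ℝ} (hε : |ε| = 1) (hH : 0 < H) :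
    Integrable fun y : ℝ => dilatedTest t ε H y * Real.sqrt (4 + |y|) := by
  obtain ⟨A, hA⟩ := dilatedTest_le (t := t) hε hH
  refine (integrable_rpow_neg_three_halves.const_mul (A * 2)).mono'
    (continuous_dilatedTest.mul (by fun_prop)).aestronglyMeasurable (.of_forall fun y => ?_)
  have h1 : Real.sqrt (4 + |y|) ≤ 2 * (1 + |y|) ^ (1 / 2 : ℝ) := by
    rw [← Real.sqrt_eq_rpow]
    refine Real.sqrt_le_iff.2 ⟨by positivity, ?_⟩
    rw [mul_pow, Real.sq_sqrt (by positivity)]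
    linarith [abs_nonneg y]
  rw [norm_mul, Real.norm_eq_abs, Real.norm_eq_abs, abs_of_nonneg (Real.sqrt_nonneg _)]
  calc _ ≤ A * (1 + |y|) ^ (-2 : ℝ) * (2 * (1 + |y|) ^ (1 / 2 : ℝ)) :=
        mul_le_mul (hA y) h1 (by positivity) ((abs_nonneg _).trans (hA y))
    _ = A * 2 * ((1 + |y|) ^ (-2 : ℝ) * (1 + |y|) ^ (1 / 2 : ℝ)) := by ring
    _ = _ := by rw [← Real.rpow_add (by positivity)]; norm_num

theorem re_one_div_vertical (δ y γ : ℝ) :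
    (1 / ((1 / 2 + δ + Complex.I * y : ℂ) - (1 / 2 + Complex.I * γ))).re = δ / (δ ^ 2 + (y - γ) ^ 2) := by
  have e : (1 / 2 + δ + Complex.I * y : ℂ) - (1 / 2 + Complex.I * γ) = ⟨δ, y - γ⟩ := by
    apply Complex.ext <;> simp
  rw [e, one_div, Complex.inv_re, Complex.normSq_mk]
  ring_nf

/-- The weighted count of two zeros on the critical line, bounded by the explicit formula. -/
theorem zeros_le_explicit (hq : 1 < q) (hχ : χ ≠ 1) (hp : χ.IsPrimitive)
    (hz : ∀ s : ℂ, 1 / 2 < s.re → LFunction χ s ≠ 0) (hε : |ε| = 1) {C : ℝ} (hC : 0 ≤ C)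
    (hgam : ∀ s : ℂ, 0 < s.re → (logDeriv χ.gammaFactor s).re ≤ C * Real.sqrt (2 + ‖s‖))
    {γ₁ γ₂ : ℝ} (hγ : γ₁ ≠ γ₂) {m n : ℕ}
    (hm : (m : ℕ∞) ≤ analyticOrderAt (LFunction χ) (1 / 2 + Complex.I * γ₁))
    (hn : (n : ℕ∞) ≤ analyticOrderAt (LFunction χ) (1 / 2 + Complex.I * γ₂)) :
    m * (Real.pi * dilatedTest t ε (Real.log q) γ₁) + n * (Real.pi * dilatedTest t ε (Real.log q) γ₂) ≤
      Real.log q / 2 * (∫ y, dilatedTest t ε (Real.log q) y) +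
      C * (∫ y, dilatedTest t ε (Real.log q) y * Real.sqrt (4 + |y|)) - (primeSum χ t ε 0).re := by
  have hlog : 0 < Real.log q := Real.log_pos (by exact_mod_cast hq)
  set F : ℝ → ℝ := dilatedTest t ε (Real.log q) with hF
  have hFc : Continuous F := continuous_dilatedTest
  obtain ⟨A, hA⟩ := dilatedTest_le (t := t) hε hlog
  have hA0 : 0 ≤ A := by
    have := (abs_nonneg _).trans (hA 0)
    simpa using this
  have hFb : ∀ y, |F y| ≤ A := fun y => (hA y).trans (mul_le_of_le_one_right hA0
    (Real.rpow_le_one_of_one_le_of_nonpos (by linarith [abs_nonneg y]) (by norm_num)))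
  have hFint : Integrable F := integrable_dilatedTest hε hlog
  have hP : ∀ γ : ℝ, ∀ δ : ℝ, 0 < δ → Integrable fun y => F y * (δ / (δ ^ 2 + (y - γ) ^ 2)) := by
    intro γ δ hδ
    refine hFint.mul_bdd (c := 1 / δ) ?_ (.of_forall fun y => ?_)
    · refine Continuous.aestronglyMeasurable (Continuous.div (by fun_prop) (by fun_prop) fun y => ?_)
      positivity
    · rw [Real.norm_eq_abs, abs_of_nonneg (by positivity), div_le_div_iff₀ (by positivity) hδ]
      nlinarith [sq_nonneg (y - γ)]
  have hlim := ((tendsto_poisson_integral hFc hFb γ₁).const_mul (m : ℝ)).add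
    ((tendsto_poisson_integral hFc hFb γ₂).const_mul (n : ℝ))
  have hlim2 : Tendsto (fun δ : ℝ => Real.log q / 2 * (∫ y, F y) +
      C * (∫ y, F y * Real.sqrt (4 + |y|)) - (primeSum χ t ε (δ : ℂ)).re) (𝓝[>] 0)
      (𝓝 (Real.log q / 2 * (∫ y, F y) +
        C * (∫ y, F y * Real.sqrt (4 + |y|)) - (primeSum χ t ε 0).re)) := by
    refine Tendsto.const_sub _ ?_
    have hc : Continuous fun δ : ℝ => (primeSum χ t ε (δ : ℂ)).re :=
      Complex.continuous_re.comp ((differentiable_primeSum χ t ε).continuous.comp Complex.continuous_ofReal)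
    have := hc.tendsto 0
    rw [Complex.ofReal_zero] at this
    exact this.mono_left nhdsWithin_le_nhds
  -- The inequality is proved on `Re s = 1/2 + δ`. As `δ → 0` the poles concentrate to point values,
  -- and the prime sum, being finite, is continuous at `0`.
  refine le_of_tendsto_of_tendsto hlim hlim2 ?_
  filter_upwards [Ioo_mem_nhdsGT (show (0 : ℝ) < 1 by norm_num)] with δ hδ
  obtain ⟨hLi, hLv⟩ := vertical_integral_eq (t := t) hq hχ hz hε (w := (δ : ℂ)) (by simpa using hδ.1)
  have hre : (∫ y : ℝ, ((F y : ℂ) * logDeriv (LFunction χ) (1 / 2 + δ + Complex.I * y)).re) =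
      -(primeSum χ t ε (δ : ℂ)).re := by
    have h1 : (∫ y : ℝ, ((F y : ℂ) * logDeriv (LFunction χ) (1 / 2 + δ + Complex.I * y)).re) =
        (∫ y : ℝ, (F y : ℂ) * logDeriv (LFunction χ) (1 / 2 + δ + Complex.I * y)).re :=
      integral_re hLi
    rw [h1, hLv, Complex.neg_re]
  have hSq := integrable_dilatedTest_mul_sqrt (t := t) hε hlog
  have hR : Integrable fun y => Real.log q / 2 * F y + C * (F y * Real.sqrt (4 + |y|)) :=
    (hFint.const_mul _).add (hSq.const_mul _)
  have hRe : Integrable fun y : ℝ =>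
      ((F y : ℂ) * logDeriv (LFunction χ) (1 / 2 + δ + Complex.I * y)).re := hLi.re
  rw [sub_eq_add_neg, ← hre, ← integral_const_mul, ← integral_const_mul, ← integral_const_mul,
    ← integral_const_mul, ← integral_add ((hP _ _ hδ.1).const_mul _) ((hP _ _ hδ.1).const_mul _),
    ← integral_add (hFint.const_mul _) (hSq.const_mul _), ← integral_add hR hRe]
  refine integral_mono (((hP _ _ hδ.1).const_mul _).add ((hP _ _ hδ.1).const_mul _))
    (hR.add hRe) fun y => ?_
  have hs : 1 / 2 < (1 / 2 + δ + Complex.I * y : ℂ).re := by simpa using hδ.1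
  have hmain := zeros_le_re_logDeriv hχ hp hz hγ hm hn hs
  rw [re_one_div_vertical, re_one_div_vertical] at hmain
  have hg := hgam (1 / 2 + δ + Complex.I * y) (by linarith)
  have hnorm : ‖(1 / 2 + δ + Complex.I * y : ℂ)‖ ≤ 2 + |y| := by
    refine (norm_add_le _ _).trans (add_le_add ((norm_add_le _ _).trans ?_) (by simp))
    rw [Complex.norm_real, Real.norm_eq_abs, abs_of_pos hδ.1]
    have h2 : ‖(1 / 2 : ℂ)‖ = 1 / 2 := by simp
    rw [h2]
    linarith [hδ.2]
  have hsq : Real.sqrt (2 + ‖(1 / 2 + δ + Complex.I * y : ℂ)‖) ≤ Real.sqrt (4 + |y|) :=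
    Real.sqrt_le_sqrt (by linarith)
  have hF0 : 0 ≤ F y := dilatedTest_nonneg y
  have hCsq := mul_le_mul_of_nonneg_left hsq hC
  simp only [Complex.re_ofReal_mul]
  have := mul_le_mul_of_nonneg_left (hmain.trans (by linarith :
    _ ≤ Real.log q / 2 + C * Real.sqrt (4 + |y|) +
      (logDeriv (LFunction χ) (1 / 2 + δ + Complex.I * y)).re)) hF0
  linarith

end

/-! ### Orders at conjugate points, and an elementary power sum. -/

section

theorem natCast_le_analyticOrderAt_conj {f g : ℂ → ℂ} {z : ℂ} (hf : AnalyticAt ℂ f z)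
    (hg : AnalyticAt ℂ g (conj z)) (hfg : ∀ s, g (conj s) = conj (f s)) {n : ℕ}
    (h : (n : ℕ∞) ≤ analyticOrderAt f z) : (n : ℕ∞) ≤ analyticOrderAt g (conj z) := by
  rw [natCast_le_analyticOrderAt hf] at h
  obtain ⟨k, hk, hfk⟩ := h
  rw [natCast_le_analyticOrderAt hg]
  have hc : Tendsto (fun s : ℂ => conj s) (𝓝 (conj z)) (𝓝 z) := by
    simpa using Complex.continuous_conj.tendsto (conj z)
  refine ⟨fun s => conj (k (conj s)), ?_, ?_⟩
  · rw [Complex.analyticAt_iff_eventually_differentiableAt] at hk ⊢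
    filter_upwards [hc.eventually hk] with s hs
    exact differentiableAt_conj_conj_iff.2 hs
  · filter_upwards [hc.eventually hfk] with s hs
    have := hfg (conj s)
    rw [Complex.conj_conj] at this
    rw [this, hs]
    simp

/-- Telescoping through `N ^ (-3/4) ≤ 4 (N ^ (1/4) - (N - 1) ^ (1/4))`. The term `n = 0` is `0` by
the convention for real powers. -/
theorem sum_range_rpow_neg_three_quarters_le (N : ℕ) :
    ∑ n ∈ Finset.range (N + 1), (n : ℝ) ^ (-3 / 4 : ℝ) ≤ 4 * (N : ℝ) ^ (1 / 4 : ℝ) := by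
  induction N with
  | zero => norm_num [Real.zero_rpow]
  | succ N ih =>
    rw [Finset.sum_range_succ]
    refine (add_le_add_left ih _).trans ?_
    have hN : (0 : ℝ) < ((N + 1 : ℕ) : ℝ) := by positivity
    set a : ℝ := ((N + 1 : ℕ) : ℝ) ^ (1 / 4 : ℝ) with ha
    set b : ℝ := (N : ℝ) ^ (1 / 4 : ℝ) with hb
    have ha0 : 0 < a := by positivity
    have hb0 : 0 ≤ b := by positivity
    have hba : b ≤ a := Real.rpow_le_rpow (by positivity) (by simp) (by norm_num)
    have ha4 : a ^ 4 = N + 1 := by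
      rw [ha, ← Real.rpow_natCast, ← Real.rpow_mul hN.le]; norm_num
    have hb4 : b ^ 4 = N := by
      rw [hb, ← Real.rpow_natCast, ← Real.rpow_mul (by positivity)]; norm_num
    have he : ((N + 1 : ℕ) : ℝ) ^ (-3 / 4 : ℝ) = (a ^ 3)⁻¹ := by
      rw [ha, ← Real.rpow_natCast, ← Real.rpow_mul hN.le, ← Real.rpow_neg hN.le]; norm_num
    have h1 : 1 ≤ 4 * (a - b) * a ^ 3 := by
      have e : (a - b) * (a ^ 3 + a ^ 2 * b + a * b ^ 2 + b ^ 3) = 1 := by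
        linear_combination ha4 - hb4
      have h2 : a ^ 3 + a ^ 2 * b + a * b ^ 2 + b ^ 3 ≤ 4 * a ^ 3 := by
        have i1 : a ^ 2 * b ≤ a ^ 2 * a := by gcongr
        have i2 : a * b ^ 2 ≤ a * a ^ 2 := by gcongr
        have i3 : b ^ 3 ≤ a ^ 3 := by gcongr
        nlinarith
      have := mul_le_mul_of_nonneg_left h2 (sub_nonneg.2 hba)
      linarith
    have h3 : (a ^ 3)⁻¹ ≤ 4 * (a - b) := by
      rwa [inv_le_iff_one_le_mul₀ (by positivity)]
    rw [he]
    linarith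

theorem sum_range_rpow_neg_three_quarters_le' (N : ℕ) :
    ∑ n ∈ Finset.range N, (n : ℝ) ^ (-3 / 4 : ℝ) ≤ 4 * (N : ℝ) ^ (1 / 4 : ℝ) :=
  (Finset.sum_le_sum_of_subset_of_nonneg (Finset.range_mono N.le_succ)
    fun _ _ _ => by positivity).trans (sum_range_rpow_neg_three_quarters_le N)

end

/-! ### Symmetry of the two zeros, and the prime sum averaged over characters. -/

section
open DirichletCharacter

variable {q : ℕ} [NeZero q] {t ε : ℝ}

theorem coe_centralOrder_eq (χ : DirichletCharacter ℂ q) (hχ : χ ≠ 1) (t : ℝ) :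
    (centralOrder χ t : ℕ∞) =
      analyticOrderAt (LFunction χ) (1 / 2 + Complex.I * ((2 * Real.pi * t / Real.log q : ℝ) : ℂ)) := by
  rw [coe_centralOrder χ hχ]
  set c : ℂ := 2 * (Real.pi : ℂ) * Complex.I * (t : ℂ) / (Real.log q : ℂ) with hc
  have h := analyticOrderAt_comp_of_deriv_ne_zero (f := LFunction χ) (g := fun s : ℂ => s + c)
    (z₀ := 1 / 2) (by fun_prop) (by simp)
  have e : shiftedL χ t = LFunction χ ∘ fun s : ℂ => s + c := rfl
  rw [e, h]
  congr 2
  rw [hc]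
  push_cast
  ring

/-- This gives each `χ` a second zero, at the conjugate point, whose order is the one counted for
`χ⁻¹`; after averaging it doubles the left side. -/
theorem centralOrder_inv_le (χ : DirichletCharacter ℂ q) (hχ : χ ≠ 1) (t : ℝ) :
    (centralOrder χ⁻¹ t : ℕ∞) ≤ analyticOrderAt (LFunction χ)
      (1 / 2 + Complex.I * ((-(2 * Real.pi * t / Real.log q) : ℝ) : ℂ)) := by
  have hi : χ⁻¹ ≠ 1 := inv_ne_one.2 hχ
  have h := natCast_le_analyticOrderAt_conj (g := LFunction χ)
    ((differentiable_LFunction hi).analyticAt _) ((differentiable_LFunction hχ).analyticAt _)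
    (fun s => by simpa using LFunction_inv_conj χ⁻¹ hi s) (coe_centralOrder_eq χ⁻¹ hi t).le
  convert h using 2
  rw [map_add, map_mul, Complex.conj_ofReal, Complex.conj_I, Complex.ofReal_neg, map_div₀,
    map_one, Complex.conj_ofNat, mul_neg, neg_mul]

theorem isPrimitive_iff_ne_one (hq : q.Prime) (χ : DirichletCharacter ℂ q) :
    χ.IsPrimitive ↔ χ ≠ 1 := by
  rw [isPrimitive_def, Ne, eq_one_iff_conductor_eq_one]
  rcases (Nat.dvd_prime hq).1 (conductor_dvd_level χ) with h | h
  · simp [h, hq.one_lt.ne]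
  · simp [h, hq.one_lt.ne']

theorem GRHModulus.LFunction_ne_zero (h : GRHModulus q) {χ : DirichletCharacter ℂ q} (hχ : χ ≠ 1)
    {s : ℂ} (hs : 1 / 2 < s.re) : LFunction χ s ≠ 0 := by
  intro h0
  rcases lt_or_ge s.re 1 with h1 | h1
  · linarith [h χ hχ s h0 (by linarith) h1]
  · exact LFunction_ne_zero_of_one_le_re χ (Or.inl hχ) h1 h0

theorem dilatedTest_apply_dilate {H : ℝ} (hH : 0 < H) (x : ℝ) :
    dilatedTest t ε H (2 * Real.pi * x / H) = windowHat t ε x ^ 2 := by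
  unfold dilatedTest
  congr 2
  field_simp

/-- Substituting `y ↦ y H` compresses the mass by `1 / H`, and `H ≥ 1` only enlarges the square
root. This is the source of the `1 / log q` in the archimedean error. -/
theorem integral_dilatedTest_mul_sqrt_le {H : ℝ} (hε : |ε| = 1) (hH : 1 ≤ H) :
    (∫ y, dilatedTest t ε H y * Real.sqrt (4 + |y|)) ≤
      (∫ y, dilatedTest t ε 1 y * Real.sqrt (4 + |y|)) / H := by
  have hH0 : 0 < H := by linarith
  have h1 := integrable_dilatedTest_mul_sqrt (t := t) hε one_pos
  have e := Measure.integral_comp_mul_right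
    (fun y => dilatedTest t ε 1 y * Real.sqrt (4 + |y|)) H
  rw [abs_of_pos (inv_pos.2 hH0), smul_eq_mul, mul_comm, ← div_eq_mul_inv] at e
  rw [← e]
  refine integral_mono (integrable_dilatedTest_mul_sqrt hε hH0) (h1.comp_mul_right' hH0.ne')
    fun y => ?_
  have e2 : dilatedTest t ε 1 (y * H) = dilatedTest t ε H y := by simp [dilatedTest]
  simp only [e2]
  refine mul_le_mul_of_nonneg_left (Real.sqrt_le_sqrt ?_) (dilatedTest_nonneg y)
  rw [abs_mul, abs_of_pos hH0]
  nlinarith [abs_nonneg y]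

/-- The coefficient of `χ n` in `primeSum χ t ε 0`. -/
noncomputable def primeCoeff (q : ℕ) (t ε : ℝ) (n : ℕ) : ℂ :=
  (ArithmeticFunction.vonMangoldt n : ℂ) / (n : ℂ) ^ (1 / 2 : ℂ) *
    (((2 * Real.pi / Real.log q : ℝ) : ℂ) * windowConv t ε (-Real.log n / Real.log q))

theorem primeSum_zero (χ : DirichletCharacter ℂ q) :
    primeSum χ t ε 0 = ∑ n ∈ Finset.range (q ^ 2), χ n * primeCoeff q t ε n := by
  unfold primeSum primeCoeff
  refine Finset.sum_congr rfl fun n _ => ?_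
  rcases eq_or_ne n 0 with rfl | hn
  · simp
  · rw [LSeries.term_of_ne_zero hn, add_zero]
    ring

/-- The bound `Λ(n) ≤ 2 log q` alone would lose a logarithm. It is regained from the linear
vanishing of `windowConv`: `2 - log n / log q = log (q² / n) / log q`, and the last logarithm is at
most `4 (q² / n) ^ (1/4)`. -/
theorem norm_primeCoeff_le (hq : 1 < q) (hε : |ε| = 1) {n : ℕ} (hn : n < q ^ 2) :
    ‖primeCoeff q t ε n‖ ≤
      2 * Real.pi / Real.log q * (32 * (q : ℝ) ^ (1 / 2 : ℝ) * (n : ℝ) ^ (-3 / 4 : ℝ)) := by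
  have hq1 : (1 : ℝ) < q := by exact_mod_cast hq
  have hH : 0 < Real.log q := Real.log_pos hq1
  rcases Nat.eq_zero_or_pos n with rfl | hn0
  · simp only [primeCoeff, ArithmeticFunction.map_zero, Complex.ofReal_zero, zero_div, zero_mul, norm_zero]
    positivity
  have hn1 : (1 : ℝ) ≤ n := by exact_mod_cast hn0
  have hnp : (0 : ℝ) < n := by linarith
  have hln : 0 ≤ Real.log n := Real.log_nonneg hn1
  have hnq : (n : ℝ) ≤ (q : ℝ) ^ 2 := by exact_mod_cast hn.le
  have hl2 : Real.log n ≤ 2 * Real.log q := by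
    have := Real.log_le_log hnp hnq
    rwa [Real.log_pow] at this
  have hΛ : ArithmeticFunction.vonMangoldt n ≤ 2 * Real.log q :=
    ArithmeticFunction.vonMangoldt_le_log.trans hl2
  have hΛ0 : 0 ≤ ArithmeticFunction.vonMangoldt n := ArithmeticFunction.vonMangoldt_nonneg
  have hW : ‖windowConv t ε (-Real.log n / Real.log q)‖ ≤
      16 / Real.log q * ((q : ℝ) ^ (1 / 2 : ℝ) * (n : ℝ) ^ (-1 / 4 : ℝ)) := by
    refine (norm_windowConv_le hε _).trans ?_
    have e : |-Real.log n / Real.log q| = Real.log n / Real.log q := by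
      rw [neg_div, abs_neg, abs_of_nonneg (by positivity)]
    have h0 : 0 ≤ 2 - Real.log n / Real.log q := by
      rw [sub_nonneg, div_le_iff₀ hH]; exact hl2
    rw [e, max_eq_left h0]
    have h1 := Real.log_le_rpow_div (x := (q : ℝ) ^ 2 / n) (by positivity)
      (show (0 : ℝ) < 1 / 4 by norm_num)
    rw [Real.log_div (by positivity) hnp.ne', Real.log_pow,
      Real.div_rpow (by positivity) hnp.le, ← Real.rpow_natCast, ← Real.rpow_mul (by positivity)] at h1
    norm_num at h1
    have e2 : (n : ℝ) ^ (-1 / 4 : ℝ) = ((n : ℝ) ^ (1 / 4 : ℝ))⁻¹ := by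
      rw [← Real.rpow_neg hnp.le]; norm_num
    rw [e2]
    have e3 : 4 * (2 - Real.log n / Real.log q) = 4 / Real.log q * (2 * Real.log q - Real.log n) := by
      field_simp
    have e4 : 16 / Real.log q * ((q : ℝ) ^ (1 / 2 : ℝ) * ((n : ℝ) ^ (1 / 4 : ℝ))⁻¹) =
        4 / Real.log q * ((q : ℝ) ^ (1 / 2 : ℝ) / (n : ℝ) ^ (1 / 4 : ℝ) * 4) := by ring
    rw [e3, e4]
    exact mul_le_mul_of_nonneg_left (by linarith) (by positivity)
  unfold primeCoeff
  rw [norm_mul, norm_mul, norm_div, Complex.norm_real, Complex.norm_real, Real.norm_of_nonneg hΛ0,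
    Real.norm_of_nonneg (show 0 ≤ 2 * Real.pi / Real.log q by positivity),
    Complex.norm_natCast_cpow_of_pos hn0]
  have e5 : (1 / 2 : ℂ).re = 1 / 2 := by norm_num
  rw [e5]
  have e6 : (n : ℝ) ^ (-3 / 4 : ℝ) = ((n : ℝ) ^ (1 / 2 : ℝ))⁻¹ * (n : ℝ) ^ (-1 / 4 : ℝ) := by
    rw [← Real.rpow_neg hnp.le, ← Real.rpow_add hnp]; norm_num
  calc _ ≤ 2 * Real.log q / (n : ℝ) ^ (1 / 2 : ℝ) * (2 * Real.pi / Real.log q *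
        (16 / Real.log q * ((q : ℝ) ^ (1 / 2 : ℝ) * (n : ℝ) ^ (-1 / 4 : ℝ)))) := by gcongr
    _ = _ := by rw [e6]; field_simp; ring

/-- Removes `n = 1`, the one member of the class `1` modulo `q` that is too small for the average.
-/
theorem primeCoeff_one : primeCoeff q t ε 1 = 0 := by simp [primeCoeff]

open Classical in
-- Orthogonality of characters; the final `1` pays for the omitted principal character.
theorem norm_sum_nonprincipal_le (hq : q.Prime) (n : ℕ) :
    ‖∑ χ ∈ (Finset.univ : Finset (DirichletCharacter ℂ q)) with χ ≠ 1, χ n‖ ≤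
      (if n % q = 1 then (q : ℝ) else 0) + 1 := by
  have h := sum_characters_eq ℂ (n := q) (n : ZMod q)
  have h2 := Finset.sum_filter_add_sum_filter_not (Finset.univ : Finset (DirichletCharacter ℂ q))
    (fun χ => χ ≠ 1) (fun χ => χ (n : ZMod q))
  have h3 : (Finset.univ : Finset (DirichletCharacter ℂ q)).filter (fun χ => ¬ χ ≠ 1) = {1} := by
    ext χ; simp
  rw [h3, Finset.sum_singleton, h] at h2
  rw [eq_sub_of_add_eq h2]
  refine (norm_sub_le _ _).trans (add_le_add ?_ (norm_le_one _ _))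
  have e : ((n : ZMod q) = 1) ↔ n % q = 1 := by
    have := ZMod.natCast_eq_natCast_iff' n 1 q
    rwa [Nat.cast_one, Nat.mod_eq_of_lt hq.one_lt] at this
  simp only [e]
  split_ifs
  · rw [Complex.norm_natCast]; exact_mod_cast Nat.totient_le q
  · simp

/-- The remaining `n` are `1 + k q` with `1 ≤ k < q`, each at least `k q`. -/
theorem sum_one_mod_le (hq : 1 < q) :
    ∑ n ∈ Finset.range (q ^ 2) with n % q = 1 ∧ n ≠ 1, (n : ℝ) ^ (-3 / 4 : ℝ) ≤
      4 * (q : ℝ) ^ (-1 / 2 : ℝ) := by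
  have hqp : (0 : ℝ) < q := by exact_mod_cast (by omega : 0 < q)
  have hsub : (Finset.range (q ^ 2)).filter (fun n => n % q = 1 ∧ n ≠ 1) ⊆
      (Finset.Ico 1 q).image fun k => 1 + k * q := by
    intro n hn
    simp only [Finset.mem_filter, Finset.mem_range, Finset.mem_image, Finset.mem_Ico] at hn ⊢
    have hd := Nat.mod_add_div n q
    refine ⟨n / q, ⟨?_, ?_⟩, ?_⟩
    · rw [Nat.one_le_iff_ne_zero]
      intro h0
      rw [h0] at hd
      omega
    · rw [Nat.div_lt_iff_lt_mul (by omega), ← sq]; exact hn.1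
    · rw [mul_comm]; omega
  refine (Finset.sum_le_sum_of_subset_of_nonneg hsub fun _ _ _ => by positivity).trans ?_
  rw [Finset.sum_image fun a _ b _ h => Nat.eq_of_mul_eq_mul_right (by omega : 0 < q) (by omega)]
  calc _ ≤ ∑ k ∈ Finset.Ico 1 q, (k : ℝ) ^ (-3 / 4 : ℝ) * (q : ℝ) ^ (-3 / 4 : ℝ) := by
        refine Finset.sum_le_sum fun k hk => ?_
        have hk1 : (0 : ℝ) < k := by exact_mod_cast (Finset.mem_Ico.1 hk).1
        rw [← Real.mul_rpow hk1.le hqp.le]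
        refine Real.rpow_le_rpow_of_nonpos (by positivity) ?_ (by norm_num)
        push_cast
        linarith
    _ = (∑ k ∈ Finset.Ico 1 q, (k : ℝ) ^ (-3 / 4 : ℝ)) * (q : ℝ) ^ (-3 / 4 : ℝ) := by
        rw [Finset.sum_mul]
    _ ≤ 4 * (q : ℝ) ^ (1 / 4 : ℝ) * (q : ℝ) ^ (-3 / 4 : ℝ) := by
        refine mul_le_mul_of_nonneg_right ?_ (by positivity)
        refine le_trans ?_ (sum_range_rpow_neg_three_quarters_le' q)
        refine Finset.sum_le_sum_of_subset_of_nonneg ?_ fun _ _ _ => by positivity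
        intro k hk
        exact Finset.mem_range.2 (Finset.mem_Ico.1 hk).2
    _ = _ := by rw [mul_assoc, ← Real.rpow_add hqp]; norm_num

open Classical in
-- The class `n ≡ 1` and the principal-character correction over all `n < q ^ 2` each contribute at
-- most `256 π q / log q`.
theorem norm_sum_primeSum_le (hq : q.Prime) (hε : |ε| = 1) :
    ‖∑ χ ∈ (Finset.univ : Finset (DirichletCharacter ℂ q)) with χ ≠ 1, primeSum χ t ε 0‖ ≤
      512 * Real.pi * q / Real.log q := by
  have hqp : (0 : ℝ) < q := by exact_mod_cast hq.pos
  have hH : 0 < Real.log q := Real.log_pos (by exact_mod_cast hq.one_lt)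
  simp_rw [primeSum_zero]
  rw [Finset.sum_comm]
  simp_rw [← Finset.sum_mul]
  set B : ℝ := 2 * Real.pi / Real.log q * (32 * (q : ℝ) ^ (1 / 2 : ℝ)) with hB
  have hB0 : 0 ≤ B := by positivity
  have hterm : ∀ n ∈ Finset.range (q ^ 2),
      ‖(∑ χ ∈ (Finset.univ : Finset (DirichletCharacter ℂ q)) with χ ≠ 1, χ n) * primeCoeff q t ε n‖ ≤
      q * B * (if n % q = 1 ∧ n ≠ 1 then (n : ℝ) ^ (-3 / 4 : ℝ) else 0) + B * (n : ℝ) ^ (-3 / 4 : ℝ) := by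
    intro n hn
    have h1 := norm_primeCoeff_le (t := t) hq.one_lt hε (Finset.mem_range.1 hn)
    rw [← mul_assoc, ← hB] at h1
    have hr : (0 : ℝ) ≤ (n : ℝ) ^ (-3 / 4 : ℝ) := by positivity
    rcases eq_or_ne n 1 with rfl | hn1
    · rw [primeCoeff_one, mul_zero, norm_zero]
      simp [hB0]
    · rw [norm_mul]
      refine (mul_le_mul (norm_sum_nonprincipal_le hq n) h1 (norm_nonneg _) (by positivity)).trans ?_
      simp only [hn1, ne_eq, not_false_eq_true, and_true]
      split_ifs <;> nlinarith
  refine (norm_sum_le_of_le _ hterm).trans ?_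
  rw [Finset.sum_add_distrib, ← Finset.mul_sum, ← Finset.mul_sum, ← Finset.sum_filter]
  have s1 := sum_one_mod_le hq.one_lt
  have s2 := sum_range_rpow_neg_three_quarters_le' (q ^ 2)
  have e2 : ((q ^ 2 : ℕ) : ℝ) ^ (1 / 4 : ℝ) = (q : ℝ) ^ (1 / 2 : ℝ) := by
    rw [Nat.cast_pow, ← Real.rpow_natCast, ← Real.rpow_mul hqp.le]; norm_num
  rw [e2] at s2
  have e3 : (q : ℝ) ^ (-1 / 2 : ℝ) = ((q : ℝ) ^ (1 / 2 : ℝ))⁻¹ := by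
    rw [← Real.rpow_neg hqp.le]; norm_num
  have e4 : (q : ℝ) ^ (1 / 2 : ℝ) * (q : ℝ) ^ (1 / 2 : ℝ) = q := by
    rw [← Real.rpow_add hqp]; norm_num
  rw [e3] at s1
  have hp : (0 : ℝ) < (q : ℝ) ^ (1 / 2 : ℝ) := by positivity
  calc _ ≤ q * B * (4 * ((q : ℝ) ^ (1 / 2 : ℝ))⁻¹) + B * (4 * (q : ℝ) ^ (1 / 2 : ℝ)) := by gcongr
    _ = 256 * Real.pi / Real.log q * (q * ((q : ℝ) ^ (1 / 2 : ℝ) * ((q : ℝ) ^ (1 / 2 : ℝ))⁻¹)) +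
        256 * Real.pi / Real.log q * ((q : ℝ) ^ (1 / 2 : ℝ) * (q : ℝ) ^ (1 / 2 : ℝ)) := by
      rw [hB]; ring
    _ = _ := by rw [e4, mul_inv_cancel₀ hp.ne']; ring

end

/-! ### Averaging over characters and the nonvanishing proportion. -/

section
open DirichletCharacter

variable {q : ℕ} [NeZero q] {t ε : ℝ}

open Classical in
theorem card_nonprincipal (hq : q.Prime) :
    (((Finset.univ : Finset (DirichletCharacter ℂ q)).filter (fun χ => χ ≠ 1)).card : ℝ) = q - 2 := by
  have h1 : Fintype.card (DirichletCharacter ℂ q) = q - 1 := by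
    rw [← Nat.card_eq_fintype_card, card_eq_totient_of_hasEnoughRootsOfUnity ℂ q, Nat.totient_prime hq]
  have h2 : ((Finset.univ : Finset (DirichletCharacter ℂ q)).filter (fun χ => χ ≠ 1)).card = q - 1 - 1 := by
    rw [Finset.filter_ne', Finset.card_erase_of_mem (Finset.mem_univ _), Finset.card_univ, h1]
  rw [h2, Nat.sub_sub, Nat.cast_sub hq.two_le]
  norm_num

/-- The order of vanishing at the conjugate points `1/2 ± 2πit / log q`, for a single character. -/
theorem centralOrder_add_centralOrder_inv_le (ht : 0 < t) (hq : q.Prime) (hq2 : 2 < q)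
    (hG : GRHModulus q) (hε : |ε| = 1) {C : ℝ} (hC : 0 ≤ C) {χ : DirichletCharacter ℂ q} (hχ : χ ≠ 1)
    (hgam : ∀ s : ℂ, 0 < s.re → (logDeriv χ.gammaFactor s).re ≤ C * Real.sqrt (2 + ‖s‖)) :
    4 * Real.pi * (1 + ε * Real.sinc (4 * Real.pi * t)) ^ 2 * (centralOrder χ t + centralOrder χ⁻¹ t) ≤
      4 * Real.pi * (1 + ε * Real.sinc (4 * Real.pi * t)) +
      C * (∫ y, dilatedTest t ε 1 y * Real.sqrt (4 + |y|)) / Real.log q - (primeSum χ t ε 0).re := by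
  have hH : 1 ≤ Real.log q := by
    rw [Real.le_log_iff_exp_le (by positivity)]
    have h3 : (3 : ℝ) ≤ q := by exact_mod_cast hq2
    linarith [Real.exp_one_lt_d9]
  have hH0 : 0 < Real.log q := by linarith
  -- Positive height makes the two conjugate points distinct.
  have hg : 0 < 2 * Real.pi * t / Real.log q := by positivity
  have h := zeros_le_explicit (t := t) hq.one_lt hχ ((isPrimitive_iff_ne_one hq χ).2 hχ)
    (fun s hs => hG.LFunction_ne_zero hχ hs) hε hC hgam (by linarith : _ ≠ _)
    (coe_centralOrder_eq χ hχ t).le (centralOrder_inv_le χ hχ t)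
  have e : -(2 * Real.pi * t / Real.log q) = 2 * Real.pi * (-t) / Real.log q := by ring
  rw [e, dilatedTest_apply_dilate hH0, dilatedTest_apply_dilate hH0, windowHat_neg_apply_sq hε,
    windowHat_apply_self, integral_dilatedTest hε hH0] at h
  have h2 := mul_le_mul_of_nonneg_left (integral_dilatedTest_mul_sqrt_le (t := t) hε hH) hC
  have e2 : Real.log q / 2 * (2 * Real.pi / Real.log q * (4 * (1 + ε * Real.sinc (4 * Real.pi * t)))) =
      4 * Real.pi * (1 + ε * Real.sinc (4 * Real.pi * t)) := by
    field_simp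
  rw [e2] at h
  rw [← mul_div_assoc] at h2
  linarith

theorem averageOrder_le (ht : 0 < t) :
    ∃ C : ℝ, 0 ≤ C ∧ ∀ (q : ℕ) [NeZero q], q.Prime → 2 < q → GRHModulus q →
      averageOrder q t ≤ 1 / 2 * (1 + |Real.sinc (4 * Real.pi * t)|)⁻¹ + C / Real.log q := by
  -- The sign in the window is chosen to turn `sinc` into its absolute value, which gives the
  -- stronger bound.
  obtain ⟨ε, hε, hεs⟩ : ∃ ε : ℝ, |ε| = 1 ∧
      ε * Real.sinc (4 * Real.pi * t) = |Real.sinc (4 * Real.pi * t)| := by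
    rcases abs_cases (Real.sinc (4 * Real.pi * t)) with h | h
    · exact ⟨1, by simp, by rw [h.1, one_mul]⟩
    · exact ⟨-1, by simp, by rw [h.1]; ring⟩
  obtain ⟨C, hC, hgam⟩ := re_logDeriv_gammaFactor_le
  set K : ℝ := C * (∫ y, dilatedTest t ε 1 y * Real.sqrt (4 + |y|)) with hK
  have hK0 : 0 ≤ K := mul_nonneg hC (integral_nonneg fun y =>
    mul_nonneg (dilatedTest_nonneg y) (Real.sqrt_nonneg _))
  -- `1536 = 3 * 512`, since `q ≤ 3 (q - 2)` for `q ≥ 3`.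
  refine ⟨K + 1536 * Real.pi, by positivity, ?_⟩
  intro q _ hq hq2 hG
  classical
  have hqr : (3 : ℝ) ≤ q := by exact_mod_cast hq2
  have hH : 0 < Real.log q := Real.log_pos (by linarith)
  set A : ℝ := 1 + |Real.sinc (4 * Real.pi * t)| with hA
  have hA1 : 1 ≤ A := by linarith [abs_nonneg (Real.sinc (4 * Real.pi * t))]
  set N : Finset (DirichletCharacter ℂ q) := Finset.univ.filter fun χ => χ ≠ 1 with hN
  have hcard : (N.card : ℝ) = q - 2 := card_nonprincipal hq
  have hsum := Finset.sum_le_sum fun χ (hχ : χ ∈ N) =>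
    centralOrder_add_centralOrder_inv_le ht hq hq2 hG hε hC (Finset.mem_filter.1 hχ).2
      (hgam q χ)
  rw [hεs, ← hA, ← hK, ← Finset.mul_sum, Finset.sum_add_distrib, Finset.sum_sub_distrib,
    Finset.sum_const, nsmul_eq_mul, hcard, ← Complex.re_sum] at hsum
  -- Inversion permutes the non-principal characters; the resulting `S + S` is where the factor
  -- `1/2` comes from.
  have hinv : ∑ χ ∈ N, (centralOrder χ⁻¹ t : ℝ) = ∑ χ ∈ N, (centralOrder χ t : ℝ) := by
    refine Finset.sum_bij' (fun χ _ => χ⁻¹) (fun χ _ => χ⁻¹) ?_ ?_ ?_ ?_ ?_ <;> simp [hN]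
  have hprime := (Complex.abs_re_le_norm _).trans (norm_sum_primeSum_le (t := t) hq hε)
  have hprime' := neg_le_of_abs_le hprime
  rw [hinv] at hsum
  unfold averageOrder
  set S : ℝ := ∑ χ ∈ N, (centralOrder χ t : ℝ) with hS
  have hq3 : (0 : ℝ) < q - 2 := by linarith
  have hpi := Real.pi_pos
  have h1 : 4 * Real.pi * A ^ 2 * (S + S) ≤
      (q - 2) * (4 * Real.pi * A + (K + 1536 * Real.pi) / Real.log q) := by
    have h2 : 512 * Real.pi * q / Real.log q ≤ (q - 2) * (1536 * Real.pi / Real.log q) := by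
      rw [← mul_div_assoc]
      refine div_le_div_of_nonneg_right ?_ hH.le
      nlinarith
    rw [add_div]
    linarith
  have h3 : S ≤ (q - 2) * (1 / 2 * A⁻¹ + (K + 1536 * Real.pi) / Real.log q) := by
    have hR : 0 ≤ (K + 1536 * Real.pi) / Real.log q := by positivity
    set R := (K + 1536 * Real.pi) / Real.log q
    -- Dividing by this factor can only shrink the error term, so its constant is kept as it is.
    have hD : 1 ≤ 8 * Real.pi * A ^ 2 := by nlinarith [Real.pi_gt_three]
    have h4 : 8 * Real.pi * A ^ 2 * S ≤ 8 * Real.pi * A ^ 2 * ((q - 2) * (1 / 2 * A⁻¹ + R)) := by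
      have e : 8 * Real.pi * A ^ 2 * ((q - 2) * (1 / 2 * A⁻¹ + R)) =
          (q - 2) * (4 * Real.pi * A + 8 * Real.pi * A ^ 2 * R) := by
        field_simp
        ring
      rw [e]
      have h5 : R ≤ 8 * Real.pi * A ^ 2 * R := le_mul_of_one_le_left hR hD
      have h6 := mul_le_mul_of_nonneg_left h5 hq3.le
      linarith
    exact le_of_mul_le_mul_left h4 (by positivity)
  rw [one_div, inv_mul_le_iff₀ hq3]
  exact h3

/-- At least a proportion `1 - averageOrder` of the primitive characters is nonvanishing. -/
theorem one_sub_averageOrder_le (hq : q.Prime) (hq2 : 2 < q) :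
    1 - averageOrder q t ≤ nonvanishingProportion q t := by
  classical
  have hqr : (3 : ℝ) ≤ q := by exact_mod_cast hq2
  have hq3 : (0 : ℝ) < q - 2 := by linarith
  have hcard := card_nonprincipal hq
  set N : Finset (DirichletCharacter ℂ q) := Finset.univ.filter fun χ => χ ≠ 1 with hN
  have e1 : {χ : DirichletCharacter ℂ q | χ.IsPrimitive} = (N : Set (DirichletCharacter ℂ q)) := by
    ext χ
    simp [hN, isPrimitive_iff_ne_one hq]
  have e2 : {χ : DirichletCharacter ℂ q | χ.IsPrimitive ∧ shiftedL χ t (1 / 2) ≠ 0} =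
      (N.filter fun χ => shiftedL χ t (1 / 2) ≠ 0 : Set (DirichletCharacter ℂ q)) := by
    ext χ
    simp [hN, isPrimitive_iff_ne_one hq]
  unfold nonvanishingProportion averageOrder
  rw [e1, e2, Set.ncard_coe_finset, Set.ncard_coe_finset, hcard, ← hN]
  -- Each vanishing character has order at least `1`; finiteness of the order matters, because an
  -- infinite one would be recorded as `0`.
  have h1 : ((N.filter fun χ => ¬ shiftedL χ t (1 / 2) ≠ 0).card : ℝ) ≤
      ∑ χ ∈ N, (centralOrder χ t : ℝ) := by
    rw [Finset.card_filter]
    push_cast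
    refine Finset.sum_le_sum fun χ hχ => ?_
    by_cases h0 : shiftedL χ t (1 / 2) = 0
    · rw [if_pos (not_not.2 h0)]
      have hχ1 : χ ≠ 1 := (Finset.mem_filter.1 hχ).2
      have h2 : analyticOrderAt (shiftedL χ t) (1 / 2) ≠ 0 :=
        analyticOrderAt_ne_zero.2 ⟨(differentiable_shiftedL χ hχ1 t).analyticAt _, h0⟩
      rw [← coe_centralOrder χ hχ1] at h2
      have h3 : centralOrder χ t ≠ 0 := by exact_mod_cast h2
      exact_mod_cast Nat.one_le_iff_ne_zero.2 h3
    · rw [if_neg (not_not.2 h0)]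
      positivity
  have h2 := Finset.card_filter_add_card_filter_not (s := N) fun χ => shiftedL χ t (1 / 2) ≠ 0
  have h3 : ((N.filter fun χ => shiftedL χ t (1 / 2) ≠ 0).card : ℝ) +
      (N.filter fun χ => ¬ shiftedL χ t (1 / 2) ≠ 0).card = q - 2 := by
    rw [← hcard]; exact_mod_cast h2
  rw [le_div_iff₀ hq3, sub_mul, one_div, mul_right_comm, inv_mul_cancel₀ hq3.ne']
  linarith

end

theorem theorem1 (t : ℝ) (ht : 0 < t) :
    (∃ C : ℝ, ∀ (q : ℕ) [NeZero q], q.Prime → 2 < q → GRHModulus q →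
      averageOrder q t ≤
        1 / 2 * (1 + |Real.sin (4 * Real.pi * t) / (4 * Real.pi * t)|)⁻¹ + C / Real.log q) ∧
    (∀ ε : ℝ, 0 < ε → ∃ Q : ℕ, ∀ (q : ℕ) [NeZero q], q.Prime → 2 < q → Q ≤ q → GRHModulus q →
      1 - 1 / 2 * (1 + |Real.sin (4 * Real.pi * t) / (4 * Real.pi * t)|)⁻¹ - ε ≤
        nonvanishingProportion q t) := by
  have hs : Real.sinc (4 * Real.pi * t) = Real.sin (4 * Real.pi * t) / (4 * Real.pi * t) :=
    Real.sinc_of_ne_zero (by positivity)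
  obtain ⟨C, hC, h⟩ := averageOrder_le ht
  rw [hs] at h
  -- This threshold is exactly what makes `C / log q ≤ ε`.
  refine ⟨⟨C, h⟩, fun ε hε => ⟨⌈Real.exp (C / ε)⌉₊, fun q _ hq hq2 hQ hG => ?_⟩⟩
  have hqr : (1 : ℝ) < q := by exact_mod_cast hq.one_lt
  have hH : 0 < Real.log q := Real.log_pos hqr
  have h1 : C / ε ≤ Real.log q :=
    (Real.le_log_iff_exp_le (by linarith)).2 (Nat.ceil_le.1 hQ)
  have h2 : C / Real.log q ≤ ε := by
    rw [div_le_iff₀ hH]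
    rwa [div_le_iff₀' hε] at h1
  have h3 := h q hq hq2 hG
  have h4 := one_sub_averageOrder_le (t := t) hq hq2
  linarith
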